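/- For every $K>0$ there exist constants $c_K,C_K>0$ and, for every $a\in\mathbb{R}$, a constant $C_{K,a}>0$, depending only on the indicated quantities, such that the following holds. Let $n\ge 2$, $p\ge 1$, $\lambda>0$, and let $\mathbf{X}$ be a mean-zero, $K$-subgaussian random vector in $\mathbb{R}^p$, i.e. $\|\langle \mathbf{X},\mathbf{x}\rangle\|_{\psi_2}\le K(\mathbb{E}\langle \mathbf{X},\mathbf{x}\rangle^2)^{1/2}$ for all $\mathbf{x}\in\mathbb{R}^p$, where $\|Y\|_{\psi_2}=\inf\{s>0:\mathbb{E}\exp(Y^2/s^2)\le 2\}$; let $\boldsymbol{\Sigma}=\mathbb{E}(\mathbf{X}\mathbf{X}^T)$ be its covariance matrix. Let $\mathbf{X}^1,\dots,\mathbf{X}^n$ be distributed as $\mathbf{X}$, let $\boldsymbol{\tau}^1,\bar{\boldsymbol{\tau}}^1,\dots,\boldsymbol{\tau}^n,\bar{\boldsymbol{\tau}}^n$ be uniformly distributed in $[-\lambda,\lambda]^p$, and let all these $3n$ random vectors be independent. Put $$\tilde{\boldsymbol{\Sigma}}'_n=\frac{\lambda^2}{n}\sum_{k=1}^n \mathrm{sign}(\mathbf{X}^k+\boldsymbol{\tau}^k)\,\mathrm{sign}(\mathbf{X}^k+\bar{\boldsymbol{\tau}}^k)^T,\qquad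 \tilde{\boldsymbol{\Sigma}}^{\mathrm{dith}}_n=\tfrac12\tilde{\boldsymbol{\Sigma}}'_n+\tfrac12(\tilde{\boldsymbol{\Sigma}}'_n)^T,$$ where $\mathrm{sign}$ acts entrywise, with $\mathrm{sign}(x)=1$ for $x\ge 0$ and $\mathrm{sign}(x)=-1$ for $x<0$. Let $\mathbf{M}\in[0,1]^{p\times p}$ be a fixed symmetric matrix, and let $t\ge 0$, with $t\ge 1$ in the case $p=1$. Denote by $\odot$ the entrywise product, by $\|\cdot\|$ the operator norm, by $\|\cdot\|_\infty$ the largest absolute value of an entry, and by $\|\cdot\|_{1\to 2}$ the largest Euclidean norm of a column. If $\lambda^2\ge c_K\log(n)\|\boldsymbol{\Sigma}\|_\infty$, then with probability at least $1-e^{-t}$ $$\|\mathbf{M}\odot\tilde{\boldsymbol{\Sigma}}^{\mathrm{dith}}_n-\mathbf{M}\odot\boldsymbol{\Sigma}\|\le C_K\left(\|\mathbf{M}\|_{1\to 2}\bigl(\lambda\|\boldsymbol{\Sigma}\|^{1/2}+\lambda^2\bigr)\sqrt{\frac{\log(p)+t}{n}}+\lambda^2\|\mathbf{M}\|\,\frac{\log(p)+t}{n}\right).$$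 If $c_K\log(n)\|\boldsymbol{\Sigma}\|_\infty\le\lambda^2\le a\log(n)\|\boldsymbol{\Sigma}\|_\infty$, then with probability at least $1-e^{-t}$ $$\|\mathbf{M}\odot\tilde{\boldsymbol{\Sigma}}^{\mathrm{dith}}_n-\mathbf{M}\odot\boldsymbol{\Sigma}\|\le C_{K,a}\left(\log(n)\|\mathbf{M}\|_{1\to 2}\sqrt{\frac{\|\boldsymbol{\Sigma}\|\,\|\boldsymbol{\Sigma}\|_\infty(\log(p)+t)}{n}}+\log(n)\|\mathbf{M}\|\,\|\boldsymbol{\Sigma}\|_\infty\frac{\log(p)+t}{n}\right).$$ -/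

import Mathlib

open MeasureTheory ProbabilityTheory
open scoped ENNReal Matrix

namespace DitheredCov

/-- The subgaussian norm `‖Y‖_{ψ₂} = inf {t > 0 : E exp (Y² / t²) ≤ 2}` of a real random variable,
with values in `[0, ∞]`; it is `∞` when there is no such `t`. -/
noncomputable def psi2Norm {Ω : Type*} [MeasurableSpace Ω] (P : Measure Ω) (Y : Ω → ℝ) : ℝ≥0∞ :=
  sInf {s : ℝ≥0∞ | ∃ t : ℝ, 0 < t ∧
    ∫⁻ ω, ENNReal.ofReal (Real.exp (Y ω ^ 2 / t ^ 2)) ∂P ≤ 2 ∧ s = ENNReal.ofReal t}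

/-- `X` is a mean-zero, `K`-subgaussian random vector in `ℝ^p`:
`‖⟨X, x⟩‖_{ψ₂} ≤ K (E ⟨X, x⟩²)^{1/2}` for all `x`. The right-hand side is a finite real number, so
the condition forces all `⟨X, x⟩` to have finite moments of every order; in particular the
integrals below are never integrals of non-integrable functions. -/
structure IsSubgaussianVector {Ω : Type*} [MeasurableSpace Ω] {p : ℕ} (K : ℝ)
    (X : Ω → Fin p → ℝ) (P : Measure Ω) : Prop where
  aemeasurable : AEMeasurable X P
  mean_zero : ∀ i, ∫ ω, X ω i ∂P = 0
  psi2Norm_le : ∀ x : Fin p → ℝ, psi2Norm P (fun ω => X ω ⬝ᵥ x) ≤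
    ENNReal.ofReal (K * Real.sqrt (∫ ω, (X ω ⬝ᵥ x) ^ 2 ∂P))

/-- The covariance matrix `E (X Xᵀ)` of a mean-zero random vector. -/
noncomputable def covMatrix {Ω : Type*} [MeasurableSpace Ω] {p : ℕ}
    (X : Ω → Fin p → ℝ) (P : Measure Ω) : Matrix (Fin p) (Fin p) ℝ :=
  Matrix.of fun i j => ∫ ω, X ω i * X ω j ∂P

/-- The operator norm (largest singular value) of a square matrix, acting on Euclidean space. -/
noncomputable def opNorm {p : ℕ} (A : Matrix (Fin p) (Fin p) ℝ) : ℝ :=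
  ‖Matrix.toEuclideanCLM (n := Fin p) (𝕜 := ℝ) A‖

/-- The max norm `max_{i,j} |A_{ij}|`. -/
noncomputable def maxNorm {p : ℕ} (A : Matrix (Fin p) (Fin p) ℝ) : ℝ :=
  ⨆ i, ⨆ j, |A i j|

/-- The largest Euclidean norm of a column, `max_j (∑_i A_{ij}²)^{1/2}`. -/
noncomputable def maxColNorm {p : ℕ} (A : Matrix (Fin p) (Fin p) ℝ) : ℝ :=
  ⨆ j, Real.sqrt (∑ i, A i j ^ 2)

/-- The entrywise one-bit quantizer, with `sign 0 = 1`. -/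
noncomputable def signVec {p : ℕ} (x : Fin p → ℝ) : Fin p → ℝ :=
  fun i => if 0 ≤ x i then 1 else -1

/-- The asymmetric two-bit estimator
`(λ² / n) ∑_k sign(x^k + τ^k) sign(x^k + τ'^k)ᵀ`. -/
noncomputable def asymEstimator {n p : ℕ} (lam : ℝ) (x τ τ' : Fin n → Fin p → ℝ) :
    Matrix (Fin p) (Fin p) ℝ :=
  (lam ^ 2 / n) • ∑ k, Matrix.vecMulVec (signVec (x k + τ k)) (signVec (x k + τ' k))

/-- The symmetrized two-bit estimator. -/
noncomputable def dithEstimator {n p : ℕ} (lam : ℝ) (x τ τ' : Fin n → Fin p → ℝ) :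
    Matrix (Fin p) (Fin p) ℝ :=
  (1 / 2 : ℝ) • asymEstimator lam x τ τ' + (1 / 2 : ℝ) • (asymEstimator lam x τ τ')ᵀ

/-- The sampling model: `Xs 1, …, Xs n` are distributed as `X`, the dithers `τ k`, `τ' k` are
uniformly distributed in `[-λ, λ]^p`, and all these `3 n` random vectors are independent. -/
structure IsDitheredSample {Ω₀ Ω : Type*} [MeasurableSpace Ω₀] [MeasurableSpace Ω] {n p : ℕ}
    (X : Ω₀ → Fin p → ℝ) (P₀ : Measure Ω₀) (lam : ℝ)
    (Xs τ τ' : Fin n → Ω → Fin p → ℝ) (P : Measure Ω) : Prop where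
  identDistrib : ∀ k, IdentDistrib (Xs k) X P P₀
  uniform : ∀ k, pdf.IsUniform (τ k) (Set.Icc (fun _ => -lam) (fun _ => lam)) P
  uniform' : ∀ k, pdf.IsUniform (τ' k) (Set.Icc (fun _ => -lam) (fun _ => lam)) P
  indep : iIndepFun (Sum.elim Xs (Sum.elim τ τ')) P

/-- The random error `‖M ⊙ Σ̃ - M ⊙ S‖` of the masked symmetrized estimator. -/
noncomputable def maskedError {Ω : Type*} {n p : ℕ} (M S : Matrix (Fin p) (Fin p) ℝ) (lam : ℝ)
    (Xs τ τ' : Fin n → Ω → Fin p → ℝ) (ω : Ω) : ℝ :=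
  opNorm (M ⊙ dithEstimator lam (fun k => Xs k ω) (fun k => τ k ω) (fun k => τ' k ω) - M ⊙ S)

end DitheredCov

/-!
Conditionally on `X`, a one-bit sample with a uniform dither satisfies
`E[λ sign (X + τ) | X] = clip λ X`, so the masked estimator is an empirical mean of independent
matrices of norm at most `λ² ‖M‖` whose common expectation is the masked covariance matrix of the
clipped vector. When the coordinates have `ψ₂`-norm below `λ / √(2 log n)`, clipping changes each
covariance by at most `4 λ² / n`. This bounds the bias, and it also bounds the matrix variance of
the summands by `λ² ((‖Σ‖ + λ²) ‖M‖²_{1→2} + 4 λ² ‖M‖² / n)`, so both estimates follow from the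
matrix Bernstein inequality. The latter rests on the Golden–Thompson inequality, obtained from the
Lie–Trotter formula and the trace inequality `tr (A B)^(2^k) ≤ tr A^(2^k) B^(2^k)`.
-/

namespace DitheredCov

section TraceInequalities

open scoped ComplexOrder

variable {𝕜 ι : Type*} [RCLike 𝕜] [Fintype ι]

theorem two_mul_re_trace_mul_le (X Y : Matrix ι ι 𝕜) :
    2 * RCLike.re (X * Y).trace ≤ RCLike.re (X * Xᴴ).trace + RCLike.re (Yᴴ * Y).trace := by
  have h := (RCLike.nonneg_iff.1
    (Matrix.posSemidef_conjTranspose_mul_self (Xᴴ - Y)).trace_nonneg).1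
  have hYX : RCLike.re (Yᴴ * Xᴴ).trace = RCLike.re (X * Y).trace := by
    rw [← Matrix.conjTranspose_mul, Matrix.trace_conjTranspose, RCLike.star_def, RCLike.conj_re]
  simp only [Matrix.conjTranspose_sub, Matrix.conjTranspose_conjTranspose, Matrix.sub_mul,
    Matrix.mul_sub, Matrix.trace_sub, map_sub, hYX] at h
  linarith

open scoped Matrix.Norms.L2Operator MatrixOrder in
theorem trace_mul_le_trace_mul {P Q R : Matrix ι ι ℝ} (hP : 0 ≤ P) (hQR : Q ≤ R) :
    (P * Q).trace ≤ (P * R).trace := by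
  classical
  obtain ⟨S, rfl⟩ := CStarAlgebra.nonneg_iff_eq_star_mul_self.mp hP
  have h := ((Matrix.le_iff.1 hQR).mul_mul_conjTranspose_same S).trace_nonneg
  rwa [Matrix.mul_sub, Matrix.sub_mul, Matrix.trace_sub, Matrix.trace_mul_cycle S R,
    Matrix.trace_mul_cycle S Q, sub_nonneg] at h

variable [DecidableEq ι]

theorem trace_mul_pow_comm (X Y : Matrix ι ι 𝕜) (n : ℕ) :
    ((X * Y) ^ n).trace = ((Y * X) ^ n).trace := by
  rcases n with _ | n
  · simp
  · rw [pow_succ, ← mul_assoc, mul_pow_mul, pow_succ, Matrix.mul_assoc, Matrix.trace_mul_comm X,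
      Matrix.mul_assoc]

-- The two inequalities need each other: each one at exponent `2 ^ (k + 1)` uses both at `2 ^ k`.
theorem re_trace_pow_two_pow_le_and_re_trace_mul_pow_two_pow_le (k : ℕ) :
    (∀ X : Matrix ι ι 𝕜,
      RCLike.re (X ^ 2 ^ (k + 1)).trace ≤ RCLike.re ((X * Xᴴ) ^ 2 ^ k).trace) ∧
    ∀ A B : Matrix ι ι 𝕜, A.IsHermitian → B.IsHermitian →
      RCLike.re ((A * B) ^ 2 ^ k).trace ≤ RCLike.re (A ^ 2 ^ k * B ^ 2 ^ k).trace := by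
  induction k with
  | zero =>
    refine ⟨fun X => ?_, fun A B _ _ => by simp⟩
    have h := two_mul_re_trace_mul_le X X
    rw [Matrix.trace_mul_comm Xᴴ X] at h
    simp only [zero_add, pow_one, pow_zero, sq]
    linarith
  | succ k ih =>
    have sq_pow (Z : Matrix ι ι 𝕜) (m : ℕ) : Z ^ 2 ^ (m + 1) = (Z * Z) ^ 2 ^ m := by
      rw [pow_succ', pow_mul, sq]
    constructor
    · intro X
      have hXX := Matrix.isHermitian_mul_conjTranspose_self X
      have hXX' := Matrix.isHermitian_conjTranspose_mul_self X
      calc RCLike.re (X ^ 2 ^ (k + 1 + 1)).trace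
          = RCLike.re ((X * X) ^ 2 ^ (k + 1)).trace := by rw [sq_pow]
        _ ≤ RCLike.re (((X * X) * (X * X)ᴴ) ^ 2 ^ k).trace := ih.1 _
        _ = RCLike.re (((X * Xᴴ) * (Xᴴ * X)) ^ 2 ^ k).trace := by
          rw [Matrix.conjTranspose_mul, trace_mul_pow_comm (X * Xᴴ), ← Matrix.mul_assoc,
            trace_mul_pow_comm _ Xᴴ]
          simp only [Matrix.mul_assoc]
        _ ≤ RCLike.re ((X * Xᴴ) ^ 2 ^ k * (Xᴴ * X) ^ 2 ^ k).trace := ih.2 _ _ hXX hXX'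
        _ ≤ RCLike.re ((X * Xᴴ) ^ 2 ^ (k + 1)).trace := by
          have h := two_mul_re_trace_mul_le ((X * Xᴴ) ^ 2 ^ k) ((Xᴴ * X) ^ 2 ^ k)
          rw [(hXX.pow _).eq, (hXX'.pow _).eq, ← pow_add, ← pow_add,
            trace_mul_pow_comm Xᴴ X] at h
          rw [pow_succ 2 k, mul_two]
          linarith
    · intro A B hA hB
      calc RCLike.re ((A * B) ^ 2 ^ (k + 1)).trace
          ≤ RCLike.re (((A * B) * (A * B)ᴴ) ^ 2 ^ k).trace := ih.1 _
        _ = RCLike.re (((A * A) * (B * B)) ^ 2 ^ k).trace := by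
          rw [Matrix.conjTranspose_mul, hA.eq, hB.eq, ← Matrix.mul_assoc,
            trace_mul_pow_comm _ A]
          simp only [Matrix.mul_assoc]
        _ ≤ RCLike.re ((A * A) ^ 2 ^ k * (B * B) ^ 2 ^ k).trace :=
          ih.2 _ _ (by rw [← sq]; exact hA.pow 2) (by rw [← sq]; exact hB.pow 2)
        _ = RCLike.re (A ^ 2 ^ (k + 1) * B ^ 2 ^ (k + 1)).trace := by rw [sq_pow, sq_pow]

end TraceInequalities

section LieTrotter

open NormedSpace Filter Topology

theorem norm_pow_sub_pow_le {𝔸 : Type*} [NormedRing 𝔸] {a b : 𝔸} {M : ℝ} (hM : 1 ≤ M)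
    (ha : ‖a‖ ≤ M) (hb : ‖b‖ ≤ M) (n : ℕ) : ‖a ^ n - b ^ n‖ ≤ n * M ^ n * ‖a - b‖ := by
  have : 0 ≤ M := by linarith
  induction n with
  | zero => simp
  | succ n ih =>
    have hbn : ‖b ^ n * (a - b)‖ ≤ M ^ n * ‖a - b‖ := by
      rcases n with _ | n
      · simp
      · refine (norm_mul_le _ _).trans ?_
        gcongr
        exact (norm_pow_le' b n.succ_pos).trans (by gcongr)
    calc ‖a ^ (n + 1) - b ^ (n + 1)‖ = ‖(a ^ n - b ^ n) * a + b ^ n * (a - b)‖ := by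
          congr 1; rw [pow_succ, pow_succ]; noncomm_ring
      _ ≤ ‖a ^ n - b ^ n‖ * ‖a‖ + M ^ n * ‖a - b‖ :=
          (norm_add_le _ _).trans (add_le_add (norm_mul_le _ _) hbn)
      _ ≤ (n * M ^ n * ‖a - b‖) * M + M ^ (n + 1) * ‖a - b‖ := by
          gcongr
          exact n.le_succ
      _ = ((n + 1 : ℕ) : ℝ) * M ^ (n + 1) * ‖a - b‖ := by push_cast; ring

variable (𝕂 : Type*) {𝔸 : Type*} [RCLike 𝕂] [NormedRing 𝔸] [NormedAlgebra 𝕂 𝔸]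

include 𝕂 in
theorem norm_exp_le_exp_norm [NormOneClass 𝔸] (x : 𝔸) : ‖exp x‖ ≤ Real.exp ‖x‖ := by
  rw [exp_eq_tsum (𝕂 := 𝕂), Real.exp_eq_exp_ℝ, exp_eq_tsum (𝕂 := ℝ)]
  refine (norm_tsum_le_tsum_norm (norm_expSeries_summable' (𝕂 := 𝕂) x)).trans ?_
  refine (norm_expSeries_summable' (𝕂 := 𝕂) x).tsum_le_tsum (fun n => ?_)
    (expSeries_summable' (𝕂 := ℝ) ‖x‖)
  rw [norm_smul, norm_inv, RCLike.norm_natCast, smul_eq_mul]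
  gcongr
  exact norm_pow_le x n

variable [CompleteSpace 𝔸]

theorem isLittleO_exp_smul_mul_exp_smul_sub (a b : 𝔸) :
    (fun t : 𝕂 => exp (t • a) * exp (t • b) - exp (t • (a + b))) =o[𝓝 0] fun t : 𝕂 => t := by
  have h := ((hasDerivAt_exp_smul_const a (0 : 𝕂)).mul
    (hasDerivAt_exp_smul_const b 0)).sub (hasDerivAt_exp_smul_const (a + b) 0)
  rw [hasDerivAt_iff_isLittleO_nhds_zero] at h
  simpa using h

variable {𝕂} in
theorem norm_exp_mul_exp_pow_sub_exp_add_le [NormOneClass 𝔸] (a b : 𝔸) {n : ℕ} (hn : n ≠ 0) :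
    ‖(exp ((n : 𝕂)⁻¹ • a) * exp ((n : 𝕂)⁻¹ • b)) ^ n - exp (a + b)‖ ≤
      n * Real.exp (‖a‖ + ‖b‖) *
        ‖exp ((n : 𝕂)⁻¹ • a) * exp ((n : 𝕂)⁻¹ • b) - exp ((n : 𝕂)⁻¹ • (a + b))‖ := by
  have hn' : (n : 𝕂) ≠ 0 := Nat.cast_ne_zero.2 hn
  have hbound (x : 𝔸) : ‖exp ((n : 𝕂)⁻¹ • x)‖ ≤ Real.exp ((n : ℝ)⁻¹ * ‖x‖) := by
    refine (norm_exp_le_exp_norm 𝕂 _).trans_eq ?_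
    rw [norm_smul, norm_inv, RCLike.norm_natCast]
  have hexp : exp ((n : 𝕂)⁻¹ • (a + b)) ^ n = exp (a + b) := by
    let := NormedAlgebra.restrictScalars ℚ 𝕂 𝔸
    rw [← exp_nsmul, ← Nat.cast_smul_eq_nsmul 𝕂, smul_smul, mul_inv_cancel₀ hn', one_smul]
  have hM : Real.exp ((n : ℝ)⁻¹ * (‖a‖ + ‖b‖)) ^ n = Real.exp (‖a‖ + ‖b‖) := by
    rw [← Real.exp_nat_mul, ← mul_assoc, mul_inv_cancel₀ (Nat.cast_ne_zero.2 hn), one_mul]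
  have hprod : ‖exp ((n : 𝕂)⁻¹ • a) * exp ((n : 𝕂)⁻¹ • b)‖ ≤
      Real.exp ((n : ℝ)⁻¹ * (‖a‖ + ‖b‖)) := by
    rw [mul_add, Real.exp_add]
    exact (norm_mul_le _ _).trans
      (mul_le_mul (hbound a) (hbound b) (norm_nonneg _) (Real.exp_nonneg _))
  have hsum : ‖exp ((n : 𝕂)⁻¹ • (a + b))‖ ≤ Real.exp ((n : ℝ)⁻¹ * (‖a‖ + ‖b‖)) :=
    (hbound _).trans (Real.exp_le_exp.2 (by gcongr; exact norm_add_le a b))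
  have h := norm_pow_sub_pow_le (Real.one_le_exp (by positivity)) hprod hsum n
  rwa [hexp, hM] at h

theorem tendsto_exp_mul_exp_pow [NormOneClass 𝔸] (a b : 𝔸) :
    Tendsto (fun n : ℕ => (exp ((n : 𝕂)⁻¹ • a) * exp ((n : 𝕂)⁻¹ • b)) ^ n) atTop
      (𝓝 (exp (a + b))) := by
  rw [tendsto_iff_norm_sub_tendsto_zero]
  have hlim : Tendsto (fun n : ℕ => (n : 𝕂)⁻¹) atTop (𝓝 0) :=
    tendsto_inv₀_cobounded.comp (tendsto_natCast_atTop_cobounded)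
  have h0 := (((isLittleO_exp_smul_mul_exp_smul_sub 𝕂 a b).comp_tendsto
    hlim).norm_norm.tendsto_div_nhds_zero).const_mul (Real.exp (‖a‖ + ‖b‖))
  rw [mul_zero] at h0
  refine squeeze_zero' (.of_forall fun n => norm_nonneg _) ?_ h0
  filter_upwards [eventually_ne_atTop 0] with n hn
  refine (norm_exp_mul_exp_pow_sub_exp_add_le a b hn).trans_eq ?_
  simp only [Function.comp_apply]
  rw [norm_inv, RCLike.norm_natCast, div_inv_eq_mul]
  ring

end LieTrotter

section MatrixExponential

open NormedSpace Filter Topology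
open scoped Matrix.Norms.L2Operator MatrixOrder

variable {ι : Type*} [Fintype ι] [DecidableEq ι]

theorem re_trace_exp_add_le {𝕜 : Type*} [RCLike 𝕜] {A B : Matrix ι ι 𝕜} (hA : A.IsHermitian)
    (hB : B.IsHermitian) :
    RCLike.re (exp (A + B)).trace ≤ RCLike.re (exp A * exp B).trace := by
  rcases isEmpty_or_nonempty ι with hι | hι
  · simp [Matrix.trace]
  have hlim := (tendsto_exp_mul_exp_pow 𝕜 A B).comp
    (tendsto_pow_atTop_atTop_of_one_lt (one_lt_two : (1 : ℕ) < 2))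
  have htrace : Continuous fun X : Matrix ι ι 𝕜 => RCLike.re X.trace :=
    RCLike.continuous_re.comp continuous_id.matrix_trace
  refine le_of_tendsto ((htrace.tendsto _).comp hlim) (.of_forall fun k => ?_)
  have hpow (X : Matrix ι ι 𝕜) : exp (((2 ^ k : ℕ) : 𝕜)⁻¹ • X) ^ 2 ^ k = exp X := by
    rw [← Matrix.exp_nsmul, ← Nat.cast_smul_eq_nsmul 𝕜, smul_smul,
      mul_inv_cancel₀ (by simp), one_smul]
  have hherm {X : Matrix ι ι 𝕜} (hX : X.IsHermitian) :
      (exp (((2 ^ k : ℕ) : 𝕜)⁻¹ • X)).IsHermitian :=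
    (IsSelfAdjoint.smul (by simp [IsSelfAdjoint]) hX : IsSelfAdjoint _).exp
  simpa only [hpow, Function.comp_apply] using
    (re_trace_pow_two_pow_le_and_re_trace_mul_pow_two_pow_le k).2 _ _ (hherm hA) (hherm hB)

theorem exp_nonneg {A : Matrix ι ι ℝ} (hA : A.IsHermitian) : 0 ≤ exp A := by
  rw [← CFC.real_exp_eq_normedSpace_exp hA.isSelfAdjoint]
  exact cfc_nonneg fun x _ => Real.exp_nonneg x

theorem exp_le_one_add_add_sq {A : Matrix ι ι ℝ} (hA : A.IsHermitian) (hnorm : ‖A‖ ≤ 1) :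
    exp A ≤ 1 + A + A ^ 2 := by
  rcases isEmpty_or_nonempty ι with hι | hι
  · exact (Subsingleton.elim _ _).le
  have hsa := hA.isSelfAdjoint
  have h : 1 + A + A ^ 2 = cfc (fun x : ℝ => 1 + x + x ^ 2) A := by
    rw [cfc_add A (fun x : ℝ => 1 + x) (fun x : ℝ => x ^ 2), cfc_const_add 1 (fun x : ℝ => x) A,
      cfc_id' ℝ A, cfc_pow_id A 2, map_one]
  rw [h, ← CFC.real_exp_eq_normedSpace_exp hsa]
  refine cfc_mono fun x hx => ?_
  have hx1 : |x| ≤ 1 := (spectrum.norm_le_norm_of_mem hx).trans hnorm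
  have := Real.abs_exp_sub_one_sub_id_le hx1
  linarith [le_abs_self (Real.exp x - 1 - x)]

theorem trace_cfc {A : Matrix ι ι ℝ} (hA : A.IsHermitian) (f : ℝ → ℝ) :
    (cfc f A).trace = ∑ i, f (hA.eigenvalues i) := by
  rw [hA.cfc_eq, Matrix.IsHermitian.cfc, Unitary.conjStarAlgAut_apply, Matrix.trace_mul_cycle,
    Unitary.coe_star_mul_self]
  simp [Matrix.trace]

theorem exp_norm_le_trace_exp_add_trace_exp_neg [Nonempty ι] {A : Matrix ι ι ℝ}
    (hA : A.IsHermitian) :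
    Real.exp ‖A‖ ≤ (exp A).trace + (exp (-A)).trace := by
  have hsa := hA.isSelfAdjoint
  obtain ⟨x, hx, hxA⟩ :=
    (IsometricContinuousFunctionalCalculus.isGreatest_norm_spectrum (𝕜 := ℝ) A).1
  have h : exp (-A) = cfc (fun x : ℝ => Real.exp (-x)) A := by
    rw [← CFC.real_exp_eq_normedSpace_exp hsa.neg, cfc_comp_neg Real.exp A]
  rw [h, ← CFC.real_exp_eq_normedSpace_exp hsa, trace_cfc hA, trace_cfc hA,
    ← Finset.sum_add_distrib, ← hxA]
  rw [hA.spectrum_real_eq_range_eigenvalues] at hx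
  obtain ⟨i, rfl⟩ := hx
  exact (Real.exp_abs_le _).trans (Finset.single_le_sum (f := fun i =>
    Real.exp (hA.eigenvalues i) + Real.exp (-hA.eigenvalues i)) (fun j _ => by positivity)
    (Finset.mem_univ i))

end MatrixExponential

section RandomMatrices

open NormedSpace
open scoped Matrix.Norms.L2Operator MatrixOrder

instance instClosedIciTopologyMatrix {ι : Type*} : ClosedIciTopology (Matrix ι ι ℝ) where
  isClosed_Ici A := by
    have h : Set.Ici A = {B | (B - A)ᴴ = B - A} ∩
        ⋂ x : ι →₀ ℝ, {B | 0 ≤ x.sum fun i xi => x.sum fun j xj => star xi * (B - A) i j * xj} := by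
      ext B
      simp [Matrix.le_iff, Matrix.PosSemidef, Matrix.IsHermitian]
    rw [h]
    refine (isClosed_eq (by fun_prop) (by fun_prop)).inter (isClosed_iInter fun x => ?_)
    exact isClosed_le continuous_const (continuous_finsetSum _ fun i _ =>
      continuous_finsetSum _ fun j _ => by fun_prop)

variable {Ω : Type*} [MeasurableSpace Ω] {P : Measure Ω}

theorem integrable_comp_of_norm_le {E F : Type*} [NormedAddCommGroup E] [ProperSpace E]
    [NormedAddCommGroup F] [IsFiniteMeasure P] {f : E → F} (hf : Continuous f) {X : Ω → E}
    (hX : AEStronglyMeasurable X P) {R : ℝ} (hR : ∀ᵐ ω ∂P, ‖X ω‖ ≤ R) :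
    Integrable (fun ω => f (X ω)) P := by
  obtain ⟨C, hC⟩ := (isCompact_closedBall (0 : E) R).exists_bound_of_continuousOn hf.continuousOn
  refine .of_bound (hf.comp_aestronglyMeasurable hX) C ?_
  filter_upwards [hR] with ω hω using hC _ (mem_closedBall_zero_iff.2 hω)

variable {ι : Type*} [Fintype ι] [DecidableEq ι]

theorem continuous_exp : Continuous (exp : Matrix ι ι ℝ → Matrix ι ι ℝ) := by
  let := NormedAlgebra.restrictScalars ℚ ℝ (Matrix ι ι ℝ)
  exact exp_continuous

theorem integral_trace {X : Ω → Matrix ι ι ℝ} (hX : Integrable X P) :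
    ∫ ω, (X ω).trace ∂P = (∫ ω, X ω ∂P).trace :=
  (Matrix.traceLinearMap ι ℝ ℝ).toContinuousLinearMap.integral_comp_comm hX

theorem integrable_trace {X : Ω → Matrix ι ι ℝ} (hX : Integrable X P) :
    Integrable (fun ω => (X ω).trace) P :=
  (Matrix.traceLinearMap ι ℝ ℝ).toContinuousLinearMap.integrable_comp hX

theorem integrable_dotProduct_mulVec {X : Ω → Matrix ι ι ℝ} (hX : Integrable X P) (x : ι → ℝ) :
    Integrable (fun ω => x ⬝ᵥ X ω *ᵥ x) P :=
  (dotProductBilin ℝ ℝ x ∘ₗ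
    (Matrix.mulVecBilin ℝ ℝ).flip x).toContinuousLinearMap.integrable_comp hX

theorem integral_dotProduct_mulVec {X : Ω → Matrix ι ι ℝ} (hX : Integrable X P) (x : ι → ℝ) :
    ∫ ω, x ⬝ᵥ X ω *ᵥ x ∂P = x ⬝ᵥ (∫ ω, X ω ∂P) *ᵥ x :=
  (dotProductBilin ℝ ℝ x ∘ₗ
    (Matrix.mulVecBilin ℝ ℝ).flip x).toContinuousLinearMap.integral_comp_comm hX

theorem integral_apply {X : Ω → Matrix ι ι ℝ} (hX : Integrable X P) (i j : ι) :
    ∫ ω, X ω i j ∂P = (∫ ω, X ω ∂P) i j :=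
  (Matrix.entryLinearMap ℝ ℝ i j).toContinuousLinearMap.integral_comp_comm hX

theorem isHermitian_integral {X : Ω → Matrix ι ι ℝ} (hX : ∀ᵐ ω ∂P, (X ω).IsHermitian) :
    (∫ ω, X ω ∂P).IsHermitian :=
  ((starL' ℝ).integral_comp_comm X).symm.trans (integral_congr_ae hX)

theorem integral_sub_integral_sq_le [IsProbabilityMeasure P] {X : Ω → Matrix ι ι ℝ}
    (hX : ∀ᵐ ω ∂P, (X ω).IsHermitian) (hint : Integrable X P)
    (hint2 : Integrable (fun ω => X ω ^ 2) P) :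
    ∫ ω, (X ω - ∫ ω', X ω' ∂P) ^ 2 ∂P ≤ ∫ ω, X ω ^ 2 ∂P := by
  set E := ∫ ω, X ω ∂P with hE
  have hsq (ω : Ω) : (X ω - E) ^ 2 = X ω ^ 2 - (X ω * E + E * X ω) + E ^ 2 := by noncomm_ring
  have hcross : Integrable (fun ω => X ω * E + E * X ω) P :=
    (hint.mul_const E).add (hint.const_mul E)
  have hsub : Integrable (fun ω => X ω ^ 2 - (X ω * E + E * X ω)) P := hint2.sub hcross
  have heq : ∫ ω, (X ω - E) ^ 2 ∂P = ∫ ω, X ω ^ 2 ∂P - E ^ 2 := by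
    simp only [hsq]
    rw [integral_add hsub (integrable_const _), integral_sub hint2 hcross,
      integral_add (hint.mul_const E) (hint.const_mul E), integral_mul_const_of_integrable hint,
      integral_const_mul_of_integrable hint, ← hE, integral_const, probReal_univ, one_smul]
    noncomm_ring
  rw [heq, sub_le_self_iff]
  exact (isHermitian_integral hX).isSelfAdjoint.sq_nonneg

theorem measureReal_lt_norm_le [Nonempty ι] [IsFiniteMeasure P] {A : Ω → Matrix ι ι ℝ}
    (hherm : ∀ᵐ ω ∂P, (A ω).IsHermitian) {θ : ℝ} (hθ : 0 ≤ θ)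
    (hint : Integrable (fun ω => exp (θ • A ω)) P)
    (hint_neg : Integrable (fun ω => exp (-θ • A ω)) P) (s : ℝ) :
    P.real {ω | s < ‖A ω‖} ≤ Real.exp (-(θ * s)) *
      (∫ ω, (exp (θ • A ω)).trace ∂P + ∫ ω, (exp (-θ • A ω)).trace ∂P) := by
  have hsmul (a : ℝ) : ∀ᵐ ω ∂P, (a • A ω).IsHermitian := by
    filter_upwards [hherm] with ω hω using hω.smul (IsSelfAdjoint.all a)
  have hmarkov := mul_meas_ge_le_integral_of_nonneg (μ := P)
    (f := fun ω => (exp (θ • A ω)).trace + (exp (-θ • A ω)).trace) (by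
      filter_upwards [hsmul θ, hsmul (-θ)] with ω hω hω'
      exact add_nonneg (Matrix.nonneg_iff_posSemidef.1 (exp_nonneg hω)).trace_nonneg
        (Matrix.nonneg_iff_posSemidef.1 (exp_nonneg hω')).trace_nonneg)
    ((integrable_trace hint).add (integrable_trace hint_neg)) (Real.exp (θ * s))
  rw [integral_add (integrable_trace hint) (integrable_trace hint_neg)] at hmarkov
  have hsub : P.real {ω | s < ‖A ω‖} ≤
      P.real {ω | Real.exp (θ * s) ≤ (exp (θ • A ω)).trace + (exp (-θ • A ω)).trace} := by
    refine ENNReal.toReal_mono (measure_ne_top P _) (measure_mono_ae ?_)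
    filter_upwards [hsmul θ] with ω hω (hs : s < ‖A ω‖)
    have h := exp_norm_le_trace_exp_add_trace_exp_neg hω
    rw [norm_smul, Real.norm_of_nonneg hθ, ← neg_smul] at h
    exact (Real.exp_le_exp.2 (mul_le_mul_of_nonneg_left hs.le hθ)).trans h
  rw [Real.exp_neg, ← div_eq_inv_mul, le_div_iff₀' (Real.exp_pos _)]
  exact (mul_le_mul_of_nonneg_left hsub (Real.exp_nonneg _)).trans hmarkov

variable [MeasurableSpace (Matrix ι ι ℝ)] [BorelSpace (Matrix ι ι ℝ)]

theorem integral_trace_exp_add_le {A B : Ω → Matrix ι ι ℝ} (hindep : IndepFun A B P)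
    (hA : ∀ᵐ ω ∂P, (A ω).IsHermitian) (hB : ∀ᵐ ω ∂P, (B ω).IsHermitian)
    (hAB : Integrable (fun ω => exp (A ω + B ω)) P)
    (hAexp : Integrable (fun ω => exp (A ω)) P) (hBexp : Integrable (fun ω => exp (B ω)) P)
    {c : ℝ} (hc : ∫ ω, exp (B ω) ∂P ≤ c • 1) :
    ∫ ω, (exp (A ω + B ω)).trace ∂P ≤ c * ∫ ω, (exp (A ω)).trace ∂P := by
  have hind : IndepFun (fun ω => exp (A ω)) (fun ω => exp (B ω)) P :=
    hindep.comp continuous_exp.measurable continuous_exp.measurable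
  have hmul := hind.integrable_bilin hAexp hBexp (ContinuousLinearMap.mul ℝ (Matrix ι ι ℝ))
  calc ∫ ω, (exp (A ω + B ω)).trace ∂P
      ≤ ∫ ω, (exp (A ω) * exp (B ω)).trace ∂P := by
        refine integral_mono_ae (integrable_trace hAB) (integrable_trace hmul) ?_
        filter_upwards [hA, hB] with ω hAω hBω
        simpa using re_trace_exp_add_le hAω hBω
    _ = ((∫ ω, exp (A ω) ∂P) * ∫ ω, exp (B ω) ∂P).trace :=
        (integral_trace hmul).trans (congrArg Matrix.trace
          (hind.integral_bilin hAexp hBexp (ContinuousLinearMap.mul ℝ (Matrix ι ι ℝ))))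
    _ ≤ ((∫ ω, exp (A ω) ∂P) * (c • 1)).trace :=
        trace_mul_le_trace_mul
          (integral_nonneg_of_ae (hA.mono fun ω hω => exp_nonneg hω)) hc
    _ = c * ∫ ω, (exp (A ω)).trace ∂P := by
        rw [Matrix.mul_smul, Matrix.mul_one, Matrix.trace_smul, smul_eq_mul, integral_trace hAexp]

variable {κ : Type*} [IsProbabilityMeasure P]

theorem integral_trace_exp_sum_le {A : κ → Ω → Matrix ι ι ℝ} (hindep : iIndepFun A P)
    (hmeas : ∀ k, AEMeasurable (A k) P) (hherm : ∀ k, ∀ᵐ ω ∂P, (A k ω).IsHermitian)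
    {R : ℝ} (hR : ∀ k, ∀ᵐ ω ∂P, ‖A k ω‖ ≤ R) {c : κ → ℝ} (hc0 : ∀ k, 0 ≤ c k)
    (hc : ∀ k, ∫ ω, exp (A k ω) ∂P ≤ c k • 1) (s : Finset κ) :
    ∫ ω, (exp (∑ k ∈ s, A k ω)).trace ∂P ≤ (∏ k ∈ s, c k) * Fintype.card ι := by
  classical
  have hint (t : Finset κ) : Integrable (fun ω => exp (∑ k ∈ t, A k ω)) P := by
    refine integrable_comp_of_norm_le continuous_exp
      (t.aemeasurable_fun_sum fun k _ => hmeas k).aestronglyMeasurable (R := t.card • R) ?_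
    filter_upwards [t.eventually_all.2 fun k _ => hR k] with ω hω
    exact (norm_sum_le_of_le t hω).trans_eq (Finset.sum_const R)
  induction s using Finset.induction_on with
  | empty => simp
  | insert k s hk ih =>
    have hind : IndepFun (fun ω => ∑ j ∈ s, A j ω) (A k) P := by
      have h := hindep.indepFun_finsetSum_of_notMem₀ hmeas hk
      rwa [Finset.sum_fn] at h
    have hsum : ∀ᵐ ω ∂P, (∑ j ∈ s, A j ω).IsHermitian := by
      filter_upwards [s.eventually_all.2 fun j _ => hherm j] with ω hω
      exact isSelfAdjoint_sum s hω
    have hinsert (ω : Ω) : ∑ j ∈ insert k s, A j ω = ∑ j ∈ s, A j ω + A k ω := by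
      rw [Finset.sum_insert hk, add_comm]
    have hk_int := hint {k}
    have hadd_int := hint (insert k s)
    simp only [Finset.sum_singleton, hinsert] at hk_int hadd_int
    simp only [hinsert, Finset.prod_insert hk, mul_assoc]
    exact (integral_trace_exp_add_le hind hsum (hherm k) hadd_int (hint s) hk_int (hc k)).trans
      (mul_le_mul_of_nonneg_left ih (hc0 k))

theorem integral_exp_le_of_integral_sq_le {A : Ω → Matrix ι ι ℝ} (hmeas : AEMeasurable A P)
    (hherm : ∀ᵐ ω ∂P, (A ω).IsHermitian) (hmean : ∫ ω, A ω ∂P = 0) {v : ℝ}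
    (hv : ∫ ω, A ω ^ 2 ∂P ≤ v • 1) (hnorm : ∀ᵐ ω ∂P, ‖A ω‖ ≤ 1) :
    ∫ ω, exp (A ω) ∂P ≤ Real.exp v • 1 := by
  have hint {f : Matrix ι ι ℝ → Matrix ι ι ℝ} (hf : Continuous f) :
      Integrable (fun ω => f (A ω)) P :=
    integrable_comp_of_norm_le hf hmeas.aestronglyMeasurable hnorm
  calc ∫ ω, exp (A ω) ∂P ≤ ∫ ω, (1 + A ω + A ω ^ 2) ∂P := by
        refine integral_mono_ae (hint continuous_exp) (hint (f := fun B => 1 + B + B ^ 2)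
          (by fun_prop)) ?_
        filter_upwards [hherm, hnorm] with ω hω hω' using exp_le_one_add_add_sq hω hω'
    _ = 1 + ∫ ω, A ω ^ 2 ∂P := by
        rw [integral_add (hint (f := fun B => 1 + B) (by fun_prop))
          (hint (f := fun B => B ^ 2) (by fun_prop)),
          integral_add (integrable_const _) (hint (f := fun B => B) continuous_id), hmean]
        simp
    _ ≤ 1 + v • 1 := by gcongr
    _ = (1 + v) • 1 := by rw [add_smul, one_smul]
    _ ≤ Real.exp v • 1 :=
        smul_le_smul_of_nonneg_right (by linarith [Real.add_one_le_exp v]) zero_le_one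

variable [Fintype κ]

theorem integral_trace_exp_smul_sum_le {A : κ → Ω → Matrix ι ι ℝ}
    (hindep : iIndepFun A P) (hmeas : ∀ k, AEMeasurable (A k) P)
    (hherm : ∀ k, ∀ᵐ ω ∂P, (A k ω).IsHermitian) {R : ℝ} (hR : ∀ k, ∀ᵐ ω ∂P, ‖A k ω‖ ≤ R)
    (hmean : ∀ k, ∫ ω, A k ω ∂P = 0) {v : κ → ℝ} (hv : ∀ k, ∫ ω, A k ω ^ 2 ∂P ≤ v k • 1)
    {θ : ℝ} (hθ : |θ| * R ≤ 1) :
    ∫ ω, (exp (θ • ∑ k, A k ω)).trace ∂P ≤ Real.exp (θ ^ 2 * ∑ k, v k) * Fintype.card ι := by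
  have hmeas' (k : κ) : AEMeasurable (fun ω => θ • A k ω) P := (hmeas k).const_smul θ
  have hherm' (k : κ) : ∀ᵐ ω ∂P, (θ • A k ω).IsHermitian := by
    filter_upwards [hherm k] with ω hω using hω.smul (IsSelfAdjoint.all θ)
  have hnorm (k : κ) : ∀ᵐ ω ∂P, ‖θ • A k ω‖ ≤ 1 := by
    filter_upwards [hR k] with ω hω
    rw [norm_smul, Real.norm_eq_abs]
    exact (mul_le_mul_of_nonneg_left hω (abs_nonneg θ)).trans hθ
  have hsq (k : κ) : ∫ ω, (θ • A k ω) ^ 2 ∂P ≤ (θ ^ 2 * v k) • 1 := by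
    simp only [smul_pow]
    rw [integral_smul, mul_smul]
    exact smul_le_smul_of_nonneg_left (hv k) (sq_nonneg θ)
  have h := integral_trace_exp_sum_le (A := fun k ω => θ • A k ω)
    (hindep.comp (fun _ B => θ • B) fun _ => measurable_const_smul θ) hmeas' hherm' hnorm
    (fun k => Real.exp_nonneg (θ ^ 2 * v k)) (fun k =>
      integral_exp_le_of_integral_sq_le (hmeas' k) (hherm' k)
        (by rw [integral_smul, hmean, smul_zero]) (hsq k) (hnorm k)) Finset.univ
  simpa only [← Finset.smul_sum, ← Real.exp_sum, ← Finset.mul_sum] using h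

theorem measureReal_lt_norm_sum_le [Nonempty ι] {A : κ → Ω → Matrix ι ι ℝ}
    (hindep : iIndepFun A P) (hmeas : ∀ k, AEMeasurable (A k) P)
    (hherm : ∀ k, ∀ᵐ ω ∂P, (A k ω).IsHermitian) {R : ℝ} (hR : ∀ k, ∀ᵐ ω ∂P, ‖A k ω‖ ≤ R)
    (hmean : ∀ k, ∫ ω, A k ω ∂P = 0) {v : κ → ℝ} (hv : ∀ k, ∫ ω, A k ω ^ 2 ∂P ≤ v k • 1)
    {θ : ℝ} (hθ0 : 0 ≤ θ) (hθ : θ * R ≤ 1) (s : ℝ) :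
    P.real {ω | s < ‖∑ k, A k ω‖} ≤
      2 * Fintype.card ι * Real.exp (θ ^ 2 * ∑ k, v k - θ * s) := by
  have hint (a : ℝ) : Integrable (fun ω => exp (a • ∑ k, A k ω)) P := by
    refine integrable_comp_of_norm_le (f := fun B => exp (a • B))
      (continuous_exp.comp (continuous_const_smul a))
      (Finset.univ.aemeasurable_fun_sum fun k _ => hmeas k).aestronglyMeasurable
      (R := ∑ _k : κ, R) ?_
    filter_upwards [ae_all_iff.2 hR] with ω hω using norm_sum_le_of_le _ fun k _ => hω k
  have hsum : ∀ᵐ ω ∂P, (∑ k, A k ω).IsHermitian := by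
    filter_upwards [ae_all_iff.2 hherm] with ω hω using isSelfAdjoint_sum _ fun k _ => hω k
  have hmgf := integral_trace_exp_smul_sum_le hindep hmeas hherm hR hmean hv (θ := θ)
    (by rwa [abs_of_nonneg hθ0])
  have hmgf_neg := integral_trace_exp_smul_sum_le hindep hmeas hherm hR hmean hv (θ := -θ)
    (by rwa [abs_neg, abs_of_nonneg hθ0])
  rw [neg_sq] at hmgf_neg
  calc P.real {ω | s < ‖∑ k, A k ω‖}
      ≤ Real.exp (-(θ * s)) * (Real.exp (θ ^ 2 * ∑ k, v k) * Fintype.card ι +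
          Real.exp (θ ^ 2 * ∑ k, v k) * Fintype.card ι) :=
        (measureReal_lt_norm_le hsum hθ0 (hint θ) (hint (-θ)) s).trans (by gcongr)
    _ = 2 * Fintype.card ι * Real.exp (θ ^ 2 * ∑ k, v k - θ * s) := by
        rw [sub_eq_neg_add, Real.exp_add]; ring

theorem exists_bernstein_exponent {V R u : ℝ} (hR : 0 < R) (hu : 0 ≤ u) :
    ∃ θ : ℝ, 0 ≤ θ ∧ θ * R ≤ 1 ∧ θ ^ 2 * V - θ * (2 * √(V * u) + 2 * R * u) ≤ -u := by
  rcases le_or_gt V (R ^ 2 * u) with h | h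
  · refine ⟨R⁻¹, by positivity, (inv_mul_cancel₀ hR.ne').le, ?_⟩
    have hV : R⁻¹ ^ 2 * V ≤ u := by
      rw [inv_pow, inv_mul_le_iff₀ (by positivity)]
      exact h
    have hRu : R⁻¹ * (2 * √(V * u) + 2 * R * u) = R⁻¹ * (2 * √(V * u)) + 2 * u := by
      field_simp
    have h0 : 0 ≤ R⁻¹ * (2 * √(V * u)) := by positivity
    linarith
  · have hV : 0 < V := lt_of_le_of_lt (by positivity) h
    refine ⟨√(u / V), Real.sqrt_nonneg _, ?_, ?_⟩
    · rw [← Real.sqrt_sq hR.le, ← Real.sqrt_mul (by positivity), Real.sqrt_le_one,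
        div_mul_eq_mul_div, div_le_one hV]
      linarith
    · have hsq : √(u / V) ^ 2 * V = u := by
        rw [Real.sq_sqrt (by positivity), div_mul_cancel₀ _ hV.ne']
      have hprod : √(u / V) * √(V * u) = u := by
        rw [← Real.sqrt_mul (by positivity), ← mul_assoc, div_mul_cancel₀ _ hV.ne',
          Real.sqrt_mul_self hu]
      have h0 : 0 ≤ √(u / V) * (2 * R * u) := by positivity
      linarith

theorem measureReal_lt_norm_sum_sub_integral_le [Nonempty ι] {B : κ → Ω → Matrix ι ι ℝ}
    (hindep : iIndepFun B P) (hmeas : ∀ k, AEMeasurable (B k) P)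
    (hherm : ∀ k, ∀ᵐ ω ∂P, (B k ω).IsHermitian) {R : ℝ} (hR0 : 0 < R)
    (hR : ∀ k, ∀ᵐ ω ∂P, ‖B k ω‖ ≤ R) {v : κ → ℝ} (hv : ∀ k, ∫ ω, B k ω ^ 2 ∂P ≤ v k • 1)
    {u : ℝ} (hu : 0 ≤ u) :
    P.real {ω | 2 * √((∑ k, v k) * u) + 4 * R * u < ‖∑ k, (B k ω - ∫ ω', B k ω' ∂P)‖} ≤
      2 * Fintype.card ι * Real.exp (-u) := by
  have hint (k : κ) {f : Matrix ι ι ℝ → Matrix ι ι ℝ} (hf : Continuous f) :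
      Integrable (fun ω => f (B k ω)) P :=
    integrable_comp_of_norm_le hf (hmeas k).aestronglyMeasurable (hR k)
  have hmean (k : κ) : ∫ ω, (B k ω - ∫ ω', B k ω' ∂P) ∂P = 0 := by
    rw [integral_sub (hint k (f := fun C => C) continuous_id) (integrable_const _)]
    simp
  have hcentered_herm (k : κ) : ∀ᵐ ω ∂P, (B k ω - ∫ ω', B k ω' ∂P).IsHermitian := by
    filter_upwards [hherm k] with ω hω using hω.sub (isHermitian_integral (hherm k))
  have hcentered_norm (k : κ) : ∀ᵐ ω ∂P, ‖B k ω - ∫ ω', B k ω' ∂P‖ ≤ 2 * R := by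
    have hE : ‖∫ ω, B k ω ∂P‖ ≤ R := by simpa using norm_integral_le_of_norm_le_const (hR k)
    filter_upwards [hR k] with ω hω
    linarith [norm_sub_le (B k ω) (∫ ω', B k ω' ∂P)]
  have hcentered_sq (k : κ) : ∫ ω, (B k ω - ∫ ω', B k ω' ∂P) ^ 2 ∂P ≤ v k • 1 :=
    (integral_sub_integral_sq_le (hherm k) (hint k continuous_id)
      (hint k (continuous_pow 2))).trans (hv k)
  obtain ⟨θ, hθ0, hθ, hle⟩ := exists_bernstein_exponent (V := ∑ k, v k) (R := 2 * R)
    (by positivity) hu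
  have h := measureReal_lt_norm_sum_le (A := fun k ω => B k ω - ∫ ω', B k ω' ∂P)
    (hindep.comp (fun k C => C - ∫ ω', B k ω' ∂P) fun k => measurable_id.sub_const _)
    (fun k => (hmeas k).sub_const _) hcentered_herm hcentered_norm hmean hcentered_sq hθ0 hθ
    (2 * √((∑ k, v k) * u) + 2 * (2 * R) * u)
  have hR4 : 2 * (2 * R) * u = 4 * R * u := by ring
  rw [hR4] at h hle
  exact h.trans (by gcongr)

end RandomMatrices

section EuclideanNorm

open scoped Matrix.Norms.L2Operator

variable {ι : Type*} [Fintype ι]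

theorem norm_toLp_sq (x : ι → ℝ) : ‖WithLp.toLp 2 x‖ ^ 2 = x ⬝ᵥ x := by
  rw [EuclideanSpace.real_norm_sq_eq]
  simp [dotProduct, sq]

theorem dotProduct_abs_abs (x : ι → ℝ) : |x| ⬝ᵥ |x| = x ⬝ᵥ x := by
  simp [dotProduct]

theorem abs_dotProduct_le (y w : ι → ℝ) {r : ℝ} (hy : ∀ i, |y i| ≤ r) :
    |y ⬝ᵥ w| ≤ r * ∑ i, |w i| := by
  rw [Finset.mul_sum]
  refine (Finset.abs_sum_le_sum_abs _ _).trans (Finset.sum_le_sum fun i _ => ?_)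
  rw [abs_mul]
  exact mul_le_mul_of_nonneg_right (hy i) (abs_nonneg _)

theorem dotProduct_mulVec_le_of_abs_sub_le {A B : Matrix ι ι ℝ} {β : ℝ}
    (h : ∀ i j, |A i j - B i j| ≤ β) (w : ι → ℝ) :
    w ⬝ᵥ A *ᵥ w ≤ w ⬝ᵥ B *ᵥ w + β * (∑ i, |w i|) ^ 2 := by
  have hrow (i : ι) : |((A - B) *ᵥ w) i| ≤ β * ∑ j, |w j| := abs_dotProduct_le _ w (h i)
  have hsub := (le_abs_self _).trans (abs_dotProduct_le _ w hrow)
  rw [Matrix.sub_mulVec, dotProduct_comm, dotProduct_sub] at hsub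
  linarith

theorem sum_row_mul_dotProduct_le {M : Matrix ι ι ℝ} {m : ℝ} (hm : ∀ j, ∑ i, M i j ^ 2 ≤ m)
    (x : ι → ℝ) : ∑ k, (M k * x) ⬝ᵥ (M k * x) ≤ m * (x ⬝ᵥ x) := by
  simp only [dotProduct, Pi.mul_apply]
  rw [Finset.sum_comm, Finset.mul_sum]
  refine Finset.sum_le_sum fun i _ => ?_
  simp only [mul_mul_mul_comm (M _ i), ← Finset.sum_mul, ← sq (M _ i)]
  exact mul_le_mul_of_nonneg_right (hm i) (mul_self_nonneg _)

variable [DecidableEq ι]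

theorem mulVec_dotProduct_mulVec_le (A : Matrix ι ι ℝ) (x : ι → ℝ) :
    A *ᵥ x ⬝ᵥ A *ᵥ x ≤ ‖A‖ ^ 2 * (x ⬝ᵥ x) := by
  rw [← norm_toLp_sq, ← norm_toLp_sq, ← mul_pow]
  exact pow_le_pow_left₀ (norm_nonneg _) (A.l2_opNorm_mulVec (WithLp.toLp 2 x)) 2

theorem dotProduct_mulVec_le (A : Matrix ι ι ℝ) (x : ι → ℝ) :
    x ⬝ᵥ A *ᵥ x ≤ ‖A‖ * (x ⬝ᵥ x) :=
  calc x ⬝ᵥ A *ᵥ x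
      = inner ℝ (WithLp.toLp 2 x) (Matrix.toEuclideanCLM (𝕜 := ℝ) A (WithLp.toLp 2 x)) :=
        (Matrix.inner_toEuclideanCLM A (WithLp.toLp 2 x) (WithLp.toLp 2 x)).symm
    _ ≤ ‖WithLp.toLp 2 x‖ * (‖A‖ * ‖WithLp.toLp 2 x‖) :=
        (real_inner_le_norm _ _).trans
          (mul_le_mul_of_nonneg_left (A.l2_opNorm_mulVec _) (norm_nonneg _))
    _ = ‖A‖ * (x ⬝ᵥ x) := by rw [← norm_toLp_sq]; ring

theorem norm_le_of_mulVec_dotProduct_le {A : Matrix ι ι ℝ} {c : ℝ} (hc : 0 ≤ c)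
    (h : ∀ x : ι → ℝ, A *ᵥ x ⬝ᵥ A *ᵥ x ≤ c ^ 2 * (x ⬝ᵥ x)) : ‖A‖ ≤ c := by
  rw [Matrix.cstar_norm_def]
  refine ContinuousLinearMap.opNorm_le_bound _ hc fun x => le_of_sq_le_sq ?_ (by positivity)
  have hx := h x.ofLp
  rwa [← norm_toLp_sq, ← norm_toLp_sq, ← mul_pow] at hx

theorem norm_le_norm_of_abs_le {A B : Matrix ι ι ℝ} (h : ∀ i j, |A i j| ≤ B i j) :
    ‖A‖ ≤ ‖B‖ := by
  refine norm_le_of_mulVec_dotProduct_le (norm_nonneg B) fun x => ?_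
  rw [← dotProduct_abs_abs x]
  refine le_trans (Finset.sum_le_sum fun i _ => ?_) (mulVec_dotProduct_mulVec_le B |x|)
  have hi : |(A *ᵥ x) i| ≤ (B *ᵥ |x|) i := by
    refine (Finset.abs_sum_le_sum_abs _ _).trans (Finset.sum_le_sum fun j _ => ?_)
    rw [abs_mul]
    exact mul_le_mul_of_nonneg_right (h i j) (abs_nonneg _)
  rw [← abs_mul_abs_self]
  exact mul_self_le_mul_self (abs_nonneg _) hi

theorem norm_hadamard_le {M A : Matrix ι ι ℝ} (hM : ∀ i j, 0 ≤ M i j) {b : ℝ} (hb : 0 ≤ b)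
    (hA : ∀ i j, |A i j| ≤ b) : ‖M ⊙ A‖ ≤ b * ‖M‖ := by
  rw [← Real.norm_of_nonneg hb, ← norm_smul]
  refine norm_le_norm_of_abs_le fun i j => ?_
  rw [Matrix.hadamard_apply, abs_mul, abs_of_nonneg (hM i j), Matrix.smul_apply, smul_eq_mul,
    mul_comm]
  exact mul_le_mul_of_nonneg_right (hA i j) (hM i j)

theorem abs_apply_le_norm (A : Matrix ι ι ℝ) (i j : ι) : |A i j| ≤ ‖A‖ := by
  have h := mulVec_dotProduct_mulVec_le A (Pi.single j 1)
  simp only [Matrix.mulVec_single_one, single_one_dotProduct, Pi.single_eq_same, mul_one] at h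
  refine abs_le_of_sq_le_sq (le_trans ?_ h) (norm_nonneg A)
  rw [sq]
  exact Finset.single_le_sum (f := fun i => A i j * A i j)
    (fun k _ => mul_self_nonneg (A k j)) (Finset.mem_univ i)

theorem sum_sq_sum_abs_row_mul_le {M : Matrix ι ι ℝ} (hM : ∀ i j, 0 ≤ M i j) (x : ι → ℝ) :
    ∑ k, (∑ i, |(M k * x) i|) ^ 2 ≤ ‖M‖ ^ 2 * (x ⬝ᵥ x) := by
  rw [← dotProduct_abs_abs x]
  refine le_of_eq_of_le (Finset.sum_congr rfl fun k _ => ?_) (mulVec_dotProduct_mulVec_le M |x|)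
  simp only [Pi.mul_apply, abs_mul, abs_of_nonneg (hM _ _), sq, Matrix.mulVec, dotProduct,
    Pi.abs_apply]

end EuclideanNorm

section EntrywiseNorms

variable {p : ℕ} (A : Matrix (Fin p) (Fin p) ℝ)

theorem maxColNorm_nonneg : 0 ≤ maxColNorm A :=
  Real.iSup_nonneg fun _ => Real.sqrt_nonneg _

theorem sum_sq_le_maxColNorm_sq (j : Fin p) : ∑ i, A i j ^ 2 ≤ maxColNorm A ^ 2 :=
  (Real.sqrt_le_left (maxColNorm_nonneg A)).1
    (le_ciSup (f := fun j => √(∑ i, A i j ^ 2)) (Set.finite_range _).bddAbove j)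

theorem maxNorm_nonneg : 0 ≤ maxNorm A :=
  Real.iSup_nonneg fun _ => Real.iSup_nonneg fun _ => abs_nonneg _

theorem abs_apply_le_maxNorm (i j : Fin p) : |A i j| ≤ maxNorm A :=
  (le_ciSup (f := fun j => |A i j|) (Set.finite_range _).bddAbove j).trans
    (le_ciSup (f := fun i => ⨆ j, |A i j|) (Set.finite_range _).bddAbove i)

theorem opNorm_nonneg : 0 ≤ opNorm A := norm_nonneg _

open scoped Matrix.Norms.L2Operator in
theorem opNorm_eq_norm : opNorm A = ‖A‖ := rfl

theorem maxNorm_le_opNorm : maxNorm A ≤ opNorm A :=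
  Real.iSup_le (fun i => Real.iSup_le (fun j => abs_apply_le_norm A i j) (opNorm_nonneg A))
    (opNorm_nonneg A)

end EntrywiseNorms

section MaskedProducts

open scoped Matrix.Norms.L2Operator MatrixOrder

variable {ι : Type*}

/-- The rank-one product `y y'ᵀ`, symmetrized and masked by `M`. The masked estimator is the
empirical mean of the masked products of the two quantizations of each sample point. -/
noncomputable def maskedProduct (M : Matrix ι ι ℝ) (y y' : ι → ℝ) : Matrix ι ι ℝ :=
  M ⊙ ((1 / 2 : ℝ) • (Matrix.vecMulVec y y' + Matrix.vecMulVec y' y))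

theorem maskedProduct_apply (M : Matrix ι ι ℝ) (y y' : ι → ℝ) (i j : ι) :
    maskedProduct M y y' i j = M i j * ((y i * y' j + y' i * y j) / 2) := by
  simp only [maskedProduct, Matrix.hadamard_apply, Matrix.smul_apply, Matrix.add_apply,
    Matrix.vecMulVec_apply, smul_eq_mul]
  ring

theorem continuous_uncurry_maskedProduct (M : Matrix ι ι ℝ) :
    Continuous (Function.uncurry (maskedProduct M)) :=
  continuous_matrix fun i j => by
    simp only [Function.uncurry_def, maskedProduct_apply]
    fun_prop

variable {M : Matrix ι ι ℝ} {r : ℝ} {y y' : ι → ℝ}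

theorem isHermitian_maskedProduct (hM : M.IsSymm) : (maskedProduct M y y').IsHermitian := by
  refine Matrix.IsHermitian.ext fun i j => ?_
  rw [star_trivial, maskedProduct_apply, maskedProduct_apply, hM.apply i j]
  ring

variable [Fintype ι]

theorem maskedProduct_mulVec_apply (x : ι → ℝ) (k : ι) :
    (maskedProduct M y y' *ᵥ x) k =
      (y k * (y' ⬝ᵥ (M k * x)) + y' k * (y ⬝ᵥ (M k * x))) / 2 := by
  simp only [Matrix.mulVec, dotProduct, maskedProduct_apply, Pi.mul_apply, Finset.mul_sum,
    ← Finset.sum_add_distrib, Finset.sum_div]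
  exact Finset.sum_congr rfl fun i _ => by ring

variable {Ω : Type*} [MeasurableSpace Ω] {P : Measure Ω} [IsFiniteMeasure P]
  {Y Y' : Ω → ι → ℝ}

theorem integrable_dotProduct_sq (hYm : AEMeasurable Y P) (hY : ∀ ω, ‖Y ω‖ ≤ r) (w : ι → ℝ) :
    Integrable (fun ω => (Y ω ⬝ᵥ w) ^ 2) P :=
  integrable_comp_of_norm_le (by fun_prop : Continuous fun y : ι → ℝ => (y ⬝ᵥ w) ^ 2)
    hYm.aestronglyMeasurable (.of_forall hY)

theorem norm_maskedProduct_le [DecidableEq ι] (hM : ∀ i j, 0 ≤ M i j) (hy : ‖y‖ ≤ r)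
    (hy' : ‖y'‖ ≤ r) : ‖maskedProduct M y y'‖ ≤ r ^ 2 * ‖M‖ := by
  refine norm_hadamard_le hM (sq_nonneg r) fun i j => ?_
  have hprod {a b : ι → ℝ} (ha : ‖a‖ ≤ r) (hb : ‖b‖ ≤ r) : |a i * b j| ≤ r ^ 2 := by
    rw [abs_mul, sq]
    exact mul_le_mul ((norm_le_pi_norm a i).trans ha) ((norm_le_pi_norm b j).trans hb)
      (abs_nonneg _) ((norm_nonneg a).trans ha)
  have hsum := abs_add_le (y i * y' j) (y' i * y j)
  simp only [Matrix.smul_apply, Matrix.add_apply, Matrix.vecMulVec_apply, smul_eq_mul, abs_mul]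
  rw [abs_of_pos (by norm_num : (0 : ℝ) < 1 / 2)]
  linarith [hprod hy hy', hprod hy' hy]

theorem integrable_comp_maskedProduct {F : Type*} [NormedAddCommGroup F]
    {f : Matrix ι ι ℝ → F} (hf : Continuous f) (hM0 : ∀ i j, 0 ≤ M i j)
    (hYm : AEMeasurable Y P) (hYm' : AEMeasurable Y' P)
    (hY : ∀ ω, ‖Y ω‖ ≤ r) (hY' : ∀ ω, ‖Y' ω‖ ≤ r) :
    Integrable (fun ω => f (maskedProduct M (Y ω) (Y' ω))) P := by
  classical
  exact integrable_comp_of_norm_le hf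
    ((continuous_uncurry_maskedProduct M).comp_aestronglyMeasurable₂
      hYm.aestronglyMeasurable hYm'.aestronglyMeasurable)
    (.of_forall fun ω => norm_maskedProduct_le hM0 (hY ω) (hY' ω))

variable [DecidableEq ι]

theorem dotProduct_maskedProduct_sq_mulVec_le (hM : M.IsSymm) (hy : ‖y‖ ≤ r) (hy' : ‖y'‖ ≤ r)
    (x : ι → ℝ) : x ⬝ᵥ maskedProduct M y y' ^ 2 *ᵥ x ≤
      r ^ 2 / 2 * ∑ k, ((y ⬝ᵥ (M k * x)) ^ 2 + (y' ⬝ᵥ (M k * x)) ^ 2) := by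
  have hsymm : (maskedProduct M y y').IsSymm := isHermitian_maskedProduct hM
  rw [sq (maskedProduct M y y'), ← Matrix.mulVec_mulVec, Matrix.dotProduct_mulVec,
    ← Matrix.mulVec_transpose, hsymm.eq, dotProduct, Finset.mul_sum]
  refine Finset.sum_le_sum fun k _ => ?_
  have hsq {v : ι → ℝ} (hv : ‖v‖ ≤ r) : v k ^ 2 ≤ r ^ 2 := by
    rw [← sq_abs]
    exact pow_le_pow_left₀ (abs_nonneg _) ((norm_le_pi_norm v k).trans hv) 2
  rw [maskedProduct_mulVec_apply]
  generalize y ⬝ᵥ (M k * x) = a, y' ⬝ᵥ (M k * x) = a'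
  calc (y k * a' + y' k * a) / 2 * ((y k * a' + y' k * a) / 2)
      ≤ (y k ^ 2 + y' k ^ 2) * (a ^ 2 + a' ^ 2) / 4 := by
        linarith [sq_nonneg (y k * a - y' k * a')]
    _ ≤ (r ^ 2 + r ^ 2) * (a ^ 2 + a' ^ 2) / 4 := by
        gcongr ?_ * _ / 4
        exact add_le_add (hsq hy) (hsq hy')
    _ = r ^ 2 / 2 * (a ^ 2 + a' ^ 2) := by ring

theorem le_smul_one_of_dotProduct_mulVec_le {A : Matrix ι ι ℝ} (hA : A.IsHermitian) {c : ℝ}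
    (h : ∀ x, x ⬝ᵥ A *ᵥ x ≤ c * (x ⬝ᵥ x)) : A ≤ c • 1 := by
  refine Matrix.le_iff.2 (.of_dotProduct_mulVec_nonneg
    ((Matrix.isHermitian_one.smul (IsSelfAdjoint.all c)).sub hA) fun x => ?_)
  rw [star_trivial, Matrix.sub_mulVec, dotProduct_sub, Matrix.smul_mulVec, Matrix.one_mulVec,
    dotProduct_smul, smul_eq_mul]
  exact sub_nonneg.2 (h x)

theorem integral_maskedProduct_sq_le (hM : M.IsSymm) (hM0 : ∀ i j, 0 ≤ M i j)
    (hYm : AEMeasurable Y P) (hYm' : AEMeasurable Y' P)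
    (hY : ∀ ω, ‖Y ω‖ ≤ r) (hY' : ∀ ω, ‖Y' ω‖ ≤ r) {s β m : ℝ} (hs : 0 ≤ s) (hβ : 0 ≤ β)
    (hY2 : ∀ w, ∫ ω, (Y ω ⬝ᵥ w) ^ 2 ∂P ≤ s * (w ⬝ᵥ w) + β * (∑ i, |w i|) ^ 2)
    (hY2' : ∀ w, ∫ ω, (Y' ω ⬝ᵥ w) ^ 2 ∂P ≤ s * (w ⬝ᵥ w) + β * (∑ i, |w i|) ^ 2)
    (hm : ∀ j, ∑ i, M i j ^ 2 ≤ m) :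
    ∫ ω, maskedProduct M (Y ω) (Y' ω) ^ 2 ∂P ≤ (r ^ 2 * (s * m + β * ‖M‖ ^ 2)) • 1 := by
  have hint := integrable_comp_maskedProduct (continuous_pow 2) hM0 hYm hYm' hY hY'
  have hdot := integrable_dotProduct_sq hYm hY
  have hdot' := integrable_dotProduct_sq hYm' hY'
  refine le_smul_one_of_dotProduct_mulVec_le (isHermitian_integral
    (.of_forall fun ω => (isHermitian_maskedProduct hM).pow 2)) fun x => ?_
  have hrow (k : ι) : ∫ ω, ((Y ω ⬝ᵥ (M k * x)) ^ 2 + (Y' ω ⬝ᵥ (M k * x)) ^ 2) ∂P ≤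
      2 * (s * ((M k * x) ⬝ᵥ (M k * x)) + β * (∑ i, |(M k * x) i|) ^ 2) := by
    rw [integral_add (hdot _) (hdot' _)]
    linarith [hY2 (M k * x), hY2' (M k * x)]
  calc x ⬝ᵥ (∫ ω, maskedProduct M (Y ω) (Y' ω) ^ 2 ∂P) *ᵥ x
      = ∫ ω, x ⬝ᵥ maskedProduct M (Y ω) (Y' ω) ^ 2 *ᵥ x ∂P :=
        (integral_dotProduct_mulVec hint x).symm
    _ ≤ ∫ ω, r ^ 2 / 2 * ∑ k, ((Y ω ⬝ᵥ (M k * x)) ^ 2 + (Y' ω ⬝ᵥ (M k * x)) ^ 2) ∂P :=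
        integral_mono (integrable_dotProduct_mulVec hint x)
          ((integrable_finsetSum _ fun k _ => (hdot _).add (hdot' _)).const_mul _)
          fun ω => dotProduct_maskedProduct_sq_mulVec_le hM (hY ω) (hY' ω) x
    _ = r ^ 2 / 2 * ∑ k, ∫ ω, ((Y ω ⬝ᵥ (M k * x)) ^ 2 + (Y' ω ⬝ᵥ (M k * x)) ^ 2) ∂P := by
        rw [integral_const_mul]
        exact congr_arg _ (integral_finsetSum _ fun k _ => (hdot _).add (hdot' _))
    _ ≤ r ^ 2 / 2 * ∑ k, 2 * (s * ((M k * x) ⬝ᵥ (M k * x)) + β * (∑ i, |(M k * x) i|) ^ 2) := by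
        gcongr with k
        exact hrow k
    _ = r ^ 2 * (s * ∑ k, (M k * x) ⬝ᵥ (M k * x) + β * ∑ k, (∑ i, |(M k * x) i|) ^ 2) := by
        rw [← Finset.mul_sum, Finset.sum_add_distrib, ← Finset.mul_sum, ← Finset.mul_sum]
        ring
    _ ≤ r ^ 2 * (s * (m * (x ⬝ᵥ x)) + β * (‖M‖ ^ 2 * (x ⬝ᵥ x))) := by
        gcongr
        exacts [sum_row_mul_dotProduct_le hm x, sum_sq_sum_abs_row_mul_le hM0 x]
    _ = r ^ 2 * (s * m + β * ‖M‖ ^ 2) * (x ⬝ᵥ x) := by ring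

end MaskedProducts

section Clipping

/-- The clipping of a real number to the interval `[-r, r]`, which is the mean of its one-bit
quantization after adding a uniform dither on `[-r, r]`. -/
noncomputable def clip (r a : ℝ) : ℝ := max (-r) (min r a)

theorem measurable_clip (r : ℝ) : Measurable (clip r) := by unfold clip; fun_prop

variable {r a b t : ℝ}

theorem abs_clip_le (hr : 0 ≤ r) (a : ℝ) : |clip r a| ≤ r :=
  abs_le.2 ⟨le_max_left _ _, max_le (by linarith) (min_le_left _ _)⟩

theorem clip_of_abs_le (h : |a| ≤ r) : clip r a = a := by
  rw [clip, min_eq_right (abs_le.1 h).2, max_eq_right (abs_le.1 h).1]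

theorem exists_clip_eq_mul (hr : 0 ≤ r) (a : ℝ) : ∃ s ∈ Set.Icc (0 : ℝ) 1, clip r a = s * a := by
  rcases le_or_gt |a| r with h | h
  · exact ⟨1, by simp, by rw [clip_of_abs_le h, one_mul]⟩
  · refine ⟨r / |a|, ⟨by positivity, div_le_one_of_le₀ h.le (abs_nonneg a)⟩, ?_⟩
    rcases lt_abs.1 h with h' | h'
    · rw [clip, min_eq_left h'.le, max_eq_right (by linarith), abs_of_pos (by linarith),
        div_mul_cancel₀ _ (by linarith)]
    · rw [clip, min_eq_right (by linarith), max_eq_left (by linarith), abs_of_neg (by linarith),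
        div_neg, neg_mul, div_mul_cancel₀ _ (by linarith)]

theorem abs_clip_mul_clip_sub_le_abs_mul (hr : 0 ≤ r) (a b : ℝ) :
    |clip r a * clip r b - a * b| ≤ |a * b| := by
  obtain ⟨s, ⟨hs0, hs1⟩, hs⟩ := exists_clip_eq_mul hr a
  obtain ⟨t, ⟨ht0, ht1⟩, ht⟩ := exists_clip_eq_mul hr b
  have hst : s * t ≤ 1 := mul_le_one₀ hs1 ht0 ht1
  rw [hs, ht, show s * a * (t * b) - a * b = -(1 - s * t) * (a * b) by ring, abs_mul, abs_neg,
    abs_of_nonneg (by linarith)]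
  exact mul_le_of_le_one_left (abs_nonneg _) (by linarith [mul_nonneg hs0 ht0])

theorem sq_le_sq_mul_exp_of_lt_abs (ht : 0 < t) (htr : t ≤ r) (hra : r < |a|) :
    a ^ 2 ≤ r ^ 2 * (Real.exp (-(r ^ 2 / t ^ 2)) * Real.exp (a ^ 2 / t ^ 2)) := by
  have hr : 0 < r := ht.trans_le htr
  have hra2 : r ^ 2 < a ^ 2 := sq_lt_sq.2 ((abs_of_pos hr).trans_lt hra)
  have hexp : (a ^ 2 - r ^ 2) / r ^ 2 ≤ (a ^ 2 - r ^ 2) / t ^ 2 := by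
    gcongr
  calc a ^ 2 = r ^ 2 * ((a ^ 2 - r ^ 2) / r ^ 2 + 1) := by field_simp; ring
    _ ≤ r ^ 2 * Real.exp ((a ^ 2 - r ^ 2) / t ^ 2) := by
      gcongr
      exact (add_le_add_left hexp 1).trans (Real.add_one_le_exp _)
    _ = r ^ 2 * (Real.exp (-(r ^ 2 / t ^ 2)) * Real.exp (a ^ 2 / t ^ 2)) := by
      rw [← Real.exp_add]
      congr 2
      ring

theorem abs_clip_mul_clip_sub_le_exp (ht : 0 < t) (htr : t ≤ r) (a b : ℝ) :
    |clip r a * clip r b - a * b| ≤ r ^ 2 * Real.exp (-(r ^ 2 / t ^ 2)) *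
      (Real.exp (a ^ 2 / t ^ 2) + Real.exp (b ^ 2 / t ^ 2)) := by
  wlog hba : |b| ≤ |a| generalizing a b
  · rw [mul_comm (clip r a), mul_comm a, add_comm (Real.exp _)]
    exact this b a (le_of_not_ge hba)
  rcases le_or_gt |a| r with ha | ha
  · rw [clip_of_abs_le ha, clip_of_abs_le (hba.trans ha), sub_self, abs_zero]
    positivity
  · calc |clip r a * clip r b - a * b|
        ≤ |a * b| := abs_clip_mul_clip_sub_le_abs_mul (ht.le.trans htr) a b
      _ ≤ |a| * |a| := by rw [abs_mul]; gcongr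
      _ = a ^ 2 := by rw [abs_mul_abs_self, sq]
      _ ≤ r ^ 2 * (Real.exp (-(r ^ 2 / t ^ 2)) * Real.exp (a ^ 2 / t ^ 2)) :=
        sq_le_sq_mul_exp_of_lt_abs ht htr ha
      _ ≤ r ^ 2 * Real.exp (-(r ^ 2 / t ^ 2)) *
          (Real.exp (a ^ 2 / t ^ 2) + Real.exp (b ^ 2 / t ^ 2)) := by
        rw [← mul_assoc]
        gcongr
        exact le_add_of_nonneg_right (Real.exp_pos _).le

variable {Ω : Type*} [MeasurableSpace Ω] {P : Measure Ω} {Y Z : Ω → ℝ}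

theorem lintegral_exp_le_two_of_psi2Norm_lt (h : psi2Norm P Y < ENNReal.ofReal t) :
    ∫⁻ ω, ENNReal.ofReal (Real.exp (Y ω ^ 2 / t ^ 2)) ∂P ≤ 2 := by
  obtain ⟨_, ⟨s, hs, hle, rfl⟩, hst⟩ := sInf_lt_iff.1 h
  have hst' : s < t := (ENNReal.ofReal_lt_ofReal_iff_of_nonneg hs.le).1 hst
  refine (lintegral_mono fun ω => ENNReal.ofReal_le_ofReal ?_).trans hle
  gcongr

theorem integrable_exp_of_psi2Norm_lt (hY : AEMeasurable Y P)
    (h : psi2Norm P Y < ENNReal.ofReal t) :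
    Integrable (fun ω => Real.exp (Y ω ^ 2 / t ^ 2)) P := by
  refine ⟨AEMeasurable.aestronglyMeasurable (by fun_prop), ?_⟩
  rw [hasFiniteIntegral_iff_ofReal (.of_forall fun ω => (Real.exp_pos _).le)]
  exact (lintegral_exp_le_two_of_psi2Norm_lt h).trans_lt ENNReal.ofNat_lt_top

theorem integral_exp_le_two_of_psi2Norm_lt (hY : AEMeasurable Y P)
    (h : psi2Norm P Y < ENNReal.ofReal t) : ∫ ω, Real.exp (Y ω ^ 2 / t ^ 2) ∂P ≤ 2 := by
  rw [integral_eq_lintegral_of_nonneg_ae (.of_forall fun ω => (Real.exp_pos _).le)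
    (integrable_exp_of_psi2Norm_lt hY h).aestronglyMeasurable]
  exact ENNReal.toReal_le_of_le_ofReal zero_le_two
    (by simpa using lintegral_exp_le_two_of_psi2Norm_lt h)

theorem memLp_two_of_psi2Norm_lt (hY : AEMeasurable Y P) (h : psi2Norm P Y < ENNReal.ofReal t) :
    MemLp Y 2 P := by
  have ht : 0 < t := ENNReal.ofReal_pos.1 (bot_le.trans_lt h)
  refine (memLp_two_iff_integrable_sq hY.aestronglyMeasurable).2
    (((integrable_exp_of_psi2Norm_lt hY h).const_mul (t ^ 2)).mono'
      (hY.pow_const 2).aestronglyMeasurable (.of_forall fun ω => ?_))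
  rw [Real.norm_of_nonneg (sq_nonneg _), mul_comm, ← div_le_iff₀ (by positivity)]
  linarith [Real.add_one_le_exp (Y ω ^ 2 / t ^ 2)]

theorem abs_integral_clip_mul_clip_sub_le [IsFiniteMeasure P] (htr : t ≤ r)
    (hYm : AEMeasurable Y P) (hZm : AEMeasurable Z P)
    (hY : psi2Norm P Y < ENNReal.ofReal t) (hZ : psi2Norm P Z < ENNReal.ofReal t) :
    |∫ ω, clip r (Y ω) * clip r (Z ω) ∂P - ∫ ω, Y ω * Z ω ∂P| ≤
      4 * r ^ 2 * Real.exp (-(r ^ 2 / t ^ 2)) := by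
  have ht : 0 < t := ENNReal.ofReal_pos.1 (bot_le.trans_lt hY)
  have hr : 0 ≤ r := ht.le.trans htr
  have hclip {W : Ω → ℝ} (hW : AEMeasurable W P) : MemLp (fun ω => clip r (W ω)) 2 P :=
    .of_bound ((measurable_clip r).comp_aemeasurable hW).aestronglyMeasurable r
      (.of_forall fun ω => abs_clip_le hr (W ω))
  have hexpY := integrable_exp_of_psi2Norm_lt hYm hY
  have hexpZ := integrable_exp_of_psi2Norm_lt hZm hZ
  have hclipmul : Integrable (fun ω => clip r (Y ω) * clip r (Z ω)) P :=
    (hclip hYm).integrable_mul (hclip hZm)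
  have hmul : Integrable (fun ω => Y ω * Z ω) P :=
    (memLp_two_of_psi2Norm_lt hYm hY).integrable_mul (memLp_two_of_psi2Norm_lt hZm hZ)
  have hexp : Integrable
      (fun ω => Real.exp (Y ω ^ 2 / t ^ 2) + Real.exp (Z ω ^ 2 / t ^ 2)) P := hexpY.add hexpZ
  rw [← integral_sub hclipmul hmul, ← Real.norm_eq_abs]
  calc ‖∫ ω, (clip r (Y ω) * clip r (Z ω) - Y ω * Z ω) ∂P‖
      ≤ ∫ ω, r ^ 2 * Real.exp (-(r ^ 2 / t ^ 2)) *
          (Real.exp (Y ω ^ 2 / t ^ 2) + Real.exp (Z ω ^ 2 / t ^ 2)) ∂P :=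
        norm_integral_le_of_norm_le (hexp.const_mul _)
          (.of_forall fun ω => abs_clip_mul_clip_sub_le_exp ht htr (Y ω) (Z ω))
    _ = r ^ 2 * Real.exp (-(r ^ 2 / t ^ 2)) *
          (∫ ω, Real.exp (Y ω ^ 2 / t ^ 2) ∂P + ∫ ω, Real.exp (Z ω ^ 2 / t ^ 2) ∂P) := by
        rw [integral_const_mul, integral_add hexpY hexpZ]
    _ ≤ r ^ 2 * Real.exp (-(r ^ 2 / t ^ 2)) * (2 + 2) := by
        gcongr
        exacts [integral_exp_le_two_of_psi2Norm_lt hYm hY,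
          integral_exp_le_two_of_psi2Norm_lt hZm hZ]
    _ = 4 * r ^ 2 * Real.exp (-(r ^ 2 / t ^ 2)) := by ring

end Clipping

section Dithering

/-- The one-bit quantizer of a real number, with output levels `±r`. -/
noncomputable def quantize (r a : ℝ) : ℝ := if 0 ≤ a then r else -r

/-- The uniform distribution on `[-r, r]`, the law of a single dither. -/
noncomputable def uniformIcc (r : ℝ) : Measure ℝ := cond volume (Set.Icc (-r) r)

variable {r : ℝ}

theorem measurable_quantize (r : ℝ) : Measurable (quantize r) :=
  Measurable.ite measurableSet_Ici measurable_const measurable_const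

theorem abs_quantize_le (hr : 0 ≤ r) (a : ℝ) : |quantize r a| ≤ r := by
  unfold quantize
  split_ifs
  · exact (abs_of_nonneg hr).le
  · exact ((abs_neg r).trans (abs_of_nonneg hr)).le

theorem isProbabilityMeasure_uniformIcc (hr : 0 < r) : IsProbabilityMeasure (uniformIcc r) :=
  cond_isProbabilityMeasure_of_finite (by simp [hr]) (by simp)

theorem real_uniformIcc_Ici_neg (hr : 0 < r) (x : ℝ) :
    (uniformIcc r).real (Set.Ici (-x)) = (clip r x + r) / (2 * r) := by
  have hinter : Set.Icc (-r) r ∩ Set.Ici (-x) = Set.Icc (-min r x) r := by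
    ext s
    rw [← max_neg_neg, Set.mem_inter_iff, Set.mem_Icc, Set.mem_Icc, Set.mem_Ici, max_le_iff]
    tauto
  have hcube : volume.real (Set.Icc (-r) r) = 2 * r := by
    rw [Real.volume_real_Icc_of_le (by linarith)]
    ring
  have hslice : volume.real (Set.Icc (-min r x) r) = clip r x + r := by
    rw [Real.volume_real_Icc, clip, max_comm, ← max_add_add_right, neg_add_cancel,
      sub_neg_eq_add, add_comm r]
  rw [measureReal_def, uniformIcc, cond_apply measurableSet_Icc, hinter, ENNReal.toReal_mul,
    ENNReal.toReal_inv, ← measureReal_def, ← measureReal_def, hcube, hslice, inv_mul_eq_div]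

theorem integral_quantize_add (hr : 0 < r) (x : ℝ) :
    ∫ s, quantize r (x + s) ∂(uniformIcc r) = clip r x := by
  have := isProbabilityMeasure_uniformIcc hr
  have hind (s : ℝ) : quantize r (x + s) = (Set.Ici (-x)).indicator (fun _ => 2 * r) s - r := by
    have hmem : s ∈ Set.Ici (-x) ↔ 0 ≤ x + s := Set.mem_Ici.trans neg_le_iff_add_nonneg'
    simp only [quantize, Set.indicator_apply, hmem]
    split_ifs <;> ring
  simp only [hind]
  rw [integral_sub ((integrable_const _).indicator measurableSet_Ici) (integrable_const _),
    integral_indicator_const _ measurableSet_Ici, real_uniformIcc_Ici_neg hr, integral_const,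
    probReal_univ, one_smul, smul_eq_mul, div_mul_cancel₀ _ (by positivity), add_sub_cancel_right]

theorem integral_sum_sq_pi {ι : Type*} [Fintype ι] {E : ι → Type*} [∀ i, MeasurableSpace (E i)]
    {μ : (i : ι) → Measure (E i)} [∀ i, IsProbabilityMeasure (μ i)] {Y : (i : ι) → E i → ℝ}
    (hY : ∀ i, MemLp (Y i) 2 (μ i)) :
    ∫ s, (∑ i, Y i (s i)) ^ 2 ∂(Measure.pi μ) =
      (∑ i, ∫ s, Y i s ∂(μ i)) ^ 2 + ∑ i, Var[Y i; μ i] := by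
  have hmp (i : ι) := measurePreserving_eval μ i
  have hYpi (i : ι) : MemLp (fun s : (i : ι) → E i => Y i (s i)) 2 (Measure.pi μ) :=
    (hY i).comp_measurePreserving (hmp i)
  have hmean (i : ι) : ∫ s : (i : ι) → E i, Y i (s i) ∂(Measure.pi μ) = ∫ s, Y i s ∂(μ i) :=
    (hmp i).hasLaw.integral_comp (hY i).aestronglyMeasurable
  have hvar := variance_eq_sub (memLp_finsetSum' Finset.univ fun i _ => hYpi i)
  rw [variance_sum_pi hY] at hvar
  simp only [Pi.pow_apply, Finset.sum_apply] at hvar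
  rw [integral_finsetSum _ fun i _ => (hYpi i).integrable one_le_two] at hvar
  simp only [hmean] at hvar
  linarith

theorem cond_pi_univ_pi {ι : Type*} [Fintype ι] {E : ι → Type*} [∀ i, MeasurableSpace (E i)]
    {μ : (i : ι) → Measure (E i)} [∀ i, SigmaFinite (μ i)] {s : (i : ι) → Set (E i)}
    (hs : ∀ i, MeasurableSet (s i)) (h0 : ∀ i, μ i (s i) ≠ 0) (htop : ∀ i, μ i (s i) ≠ ∞) :
    cond (Measure.pi μ) (Set.univ.pi s) = Measure.pi fun i => cond (μ i) (s i) := by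
  have (i : ι) := cond_isProbabilityMeasure_of_finite (h0 i) (htop i)
  refine (Measure.pi_eq fun t _ => ?_).symm
  rw [cond_apply (.univ_pi hs), ← Set.pi_inter_distrib, Measure.pi_pi, Measure.pi_pi,
    ENNReal.prod_inv_distrib fun _ _ j _ _ => .inr (htop j), ← Finset.prod_mul_distrib]
  simp only [cond_apply (hs _)]

variable {ι : Type*}

/-- The entrywise clipping of a vector. -/
noncomputable def clipVec (r : ℝ) (x : ι → ℝ) : ι → ℝ := fun i => clip r (x i)

/-- The entrywise one-bit quantization of a vector, with output levels `±r`. -/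
noncomputable def quantizeVec (r : ℝ) (x : ι → ℝ) : ι → ℝ := fun i => quantize r (x i)

theorem smul_signVec {p : ℕ} (r : ℝ) (x : Fin p → ℝ) : r • signVec x = quantizeVec r x := by
  ext i
  simp only [Pi.smul_apply, signVec, quantizeVec, quantize, smul_eq_mul]
  split_ifs <;> ring

theorem measurable_clipVec (r : ℝ) : Measurable (clipVec r : (ι → ℝ) → ι → ℝ) :=
  measurable_pi_lambda _ fun i => (measurable_clip r).comp (measurable_pi_apply i)

@[fun_prop]
theorem measurable_quantizeVec (r : ℝ) : Measurable (quantizeVec r : (ι → ℝ) → ι → ℝ) :=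
  measurable_pi_lambda _ fun i => (measurable_quantize r).comp (measurable_pi_apply i)

theorem aemeasurable_quantizeVec_add {Ω : Type*} [MeasurableSpace Ω] {P : Measure Ω}
    {X τ : Ω → ι → ℝ} (hX : AEMeasurable X P) (hτ : AEMeasurable τ P) :
    AEMeasurable (fun ω => quantizeVec r (X ω + τ ω)) P :=
  (measurable_quantizeVec r).comp_aemeasurable (hX.add hτ)

variable [Fintype ι]

theorem norm_clipVec_le (hr : 0 ≤ r) (x : ι → ℝ) : ‖clipVec r x‖ ≤ r :=
  (pi_norm_le_iff_of_nonneg hr).2 fun i => abs_clip_le hr (x i)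

theorem norm_quantizeVec_le (hr : 0 ≤ r) (x : ι → ℝ) : ‖quantizeVec r x‖ ≤ r :=
  (pi_norm_le_iff_of_nonneg hr).2 fun i => abs_quantize_le hr (x i)

variable (ι) in
/-- The uniform distribution on the cube `[-r, r]^ι`, the law of a dither vector. -/
noncomputable def uniformCube (r : ℝ) : Measure (ι → ℝ) := Measure.pi fun _ => uniformIcc r

theorem isProbabilityMeasure_uniformCube (hr : 0 < r) :
    IsProbabilityMeasure (uniformCube ι r) := by
  have := isProbabilityMeasure_uniformIcc hr
  unfold uniformCube
  infer_instance

theorem hasLaw_uniformCube (hr : 0 < r) {Ω : Type*} [MeasurableSpace Ω] {P : Measure Ω}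
    {T : Ω → ι → ℝ} (hT : pdf.IsUniform T (Set.Icc (fun _ => -r) fun _ => r) P) :
    HasLaw T (uniformCube ι r) P := by
  have hIcc : Set.Icc (fun _ : ι => -r) (fun _ => r) = Set.univ.pi fun _ => Set.Icc (-r) r :=
    (Set.pi_univ_Icc _ _).symm
  have h0 : volume (Set.Icc (-r) r) ≠ 0 := by simp [hr]
  refine ⟨hT.aemeasurable ?_ isCompact_Icc.measure_lt_top.ne, hT.trans ?_⟩
  · rw [hIcc, volume_pi_pi]
    exact Finset.prod_ne_zero_iff.2 fun _ _ => h0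
  · rw [hIcc, volume_pi]
    exact cond_pi_univ_pi (fun _ => measurableSet_Icc) (fun _ => h0)
      fun _ => isCompact_Icc.measure_lt_top.ne

theorem integral_quantizeVec_add_apply (hr : 0 < r) (x : ι → ℝ) (i : ι) :
    ∫ s, quantizeVec r (x + s) i ∂(uniformCube ι r) = clipVec r x i := by
  have := isProbabilityMeasure_uniformIcc hr
  have hlaw := (measurePreserving_eval (fun _ : ι => uniformIcc r) i).hasLaw
  have hm : Measurable fun s => quantize r (x i + s) :=
    (measurable_quantize r).comp (measurable_const_add _)
  exact (hlaw.integral_comp hm.aestronglyMeasurable).trans (integral_quantize_add hr (x i))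

theorem integral_quantizeVec_add_dotProduct_sq_le (hr : 0 < r) (x w : ι → ℝ) :
    ∫ s, (quantizeVec r (x + s) ⬝ᵥ w) ^ 2 ∂(uniformCube ι r) ≤
      (clipVec r x ⬝ᵥ w) ^ 2 + r ^ 2 * (w ⬝ᵥ w) := by
  have := isProbabilityMeasure_uniformIcc hr
  have hm (i : ι) : AEStronglyMeasurable (fun s => quantize r (x i + s)) (uniformIcc r) :=
    ((measurable_quantize r).comp (measurable_const_add _)).aestronglyMeasurable
  have hLp (i : ι) : MemLp (fun s => quantize r (x i + s) * w i) 2 (uniformIcc r) :=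
    (MemLp.of_bound (hm i) r (.of_forall fun s => abs_quantize_le hr.le _)).mul_const (w i)
  have hvar (i : ι) : Var[fun s => quantize r (x i + s) * w i; uniformIcc r] ≤
      r ^ 2 * (w i * w i) := by
    refine (variance_mul_const (w i) _ _).trans_le ?_
    rw [← sq]
    gcongr
    refine (variance_le_expectation_sq (hm i)).trans_eq ?_
    have hsq (s : ℝ) : quantize r (x i + s) ^ 2 = r ^ 2 := by
      unfold quantize
      split_ifs
      exacts [rfl, neg_sq r]
    simp [hsq]
  calc ∫ s, (quantizeVec r (x + s) ⬝ᵥ w) ^ 2 ∂(uniformCube ι r)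
      = (∑ i, ∫ s, quantize r (x i + s) * w i ∂(uniformIcc r)) ^ 2 +
          ∑ i, Var[fun s => quantize r (x i + s) * w i; uniformIcc r] :=
        integral_sum_sq_pi hLp
    _ ≤ (clipVec r x ⬝ᵥ w) ^ 2 + r ^ 2 * (w ⬝ᵥ w) := by
        simp only [integral_mul_const, integral_quantize_add hr]
        exact add_le_add le_rfl
          ((Finset.sum_le_sum fun i _ => hvar i).trans_eq (Finset.mul_sum ..).symm)

end Dithering

section Independence

variable {Ω E F κ : Type*} [MeasurableSpace Ω] [MeasurableSpace E] [MeasurableSpace F]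
  {P : Measure Ω} [IsProbabilityMeasure P]

theorem integral_comp_of_indepFun {X : Ω → E} {T : Ω → F} {μ : Measure F}
    (hX : AEMeasurable X P) (hT : HasLaw T μ P) (hXT : IndepFun X T P) {f : E → F → ℝ}
    (hf : Measurable (Function.uncurry f)) {C : ℝ} (hC : ∀ x t, |f x t| ≤ C) :
    ∫ ω, f (X ω) (T ω) ∂P = ∫ ω, ∫ t, f (X ω) t ∂μ ∂P := by
  have := Measure.isProbabilityMeasure_map hX
  have : IsProbabilityMeasure μ := hT.map_eq ▸ Measure.isProbabilityMeasure_map hT.aemeasurable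
  have hXlaw : HasLaw X (P.map X) P := ⟨hX, rfl⟩
  calc ∫ ω, f (X ω) (T ω) ∂P
      = ∫ z, Function.uncurry f z ∂((P.map X).prod μ) :=
        ((indepFun_iff_hasLaw_prodMk_prod hXlaw hT).1 hXT).integral_comp hf.aestronglyMeasurable
    _ = ∫ x, ∫ t, f x t ∂μ ∂(P.map X) :=
        integral_prod _ (.of_bound hf.aestronglyMeasurable C (.of_forall fun z => hC z.1 z.2))
    _ = ∫ ω, ∫ t, f (X ω) t ∂μ ∂P :=
        integral_map hX hf.stronglyMeasurable.integral_prod_right.aestronglyMeasurable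

theorem iIndepFun_of_indepFun_finset {E : κ → Type*} [∀ k, MeasurableSpace (E k)]
    {T : (k : κ) → Ω → E k}
    (h : ∀ (s : Finset κ) (k : κ), k ∉ s → IndepFun (fun ω (j : s) => T j ω) (T k) P) :
    iIndepFun T P := by
  classical
  rw [iIndepFun_iff_measure_inter_preimage_eq_mul]
  intro s
  induction s using Finset.induction_on with
  | empty => simp
  | insert k s hk ih =>
    intro A hA
    have hs : ⋂ i ∈ s, T i ⁻¹' A i =
        (fun ω (j : s) => T j ω) ⁻¹' Set.univ.pi fun j : s => A j := by
      ext ω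
      simp
    rw [Finset.prod_insert hk, ← ih fun i hi => hA i (Finset.mem_insert_of_mem hi),
      Finset.set_biInter_insert, hs, Set.inter_comm, (h s k hk).measure_inter_preimage_eq_mul _ _
        (.univ_pi fun j => hA j (Finset.mem_insert_of_mem j.2)) (hA k (Finset.mem_insert_self k s)),
      mul_comm]

theorem iIndepFun_prodMk_of_sumElim {f g h : κ → Ω → E}
    (hind : iIndepFun (Sum.elim f (Sum.elim g h)) P) (hf : ∀ k, AEMeasurable (f k) P)
    (hg : ∀ k, AEMeasurable (g k) P) (hh : ∀ k, AEMeasurable (h k) P) :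
    iIndepFun (fun k ω => (f k ω, g k ω, h k ω)) P := by
  classical
  refine iIndepFun_of_indepFun_finset fun s k hk => ?_
  have hdisj : Disjoint (s.disjSum (s.disjSum s)) (({k} : Finset κ).disjSum
      (({k} : Finset κ).disjSum {k})) := by
    rw [Finset.disjoint_left]
    rintro (j | j | j) hj hjk <;>
      simp only [Finset.inl_mem_disjSum, Finset.inr_mem_disjSum, Finset.mem_singleton] at hj hjk <;>
      exact hk (hjk ▸ hj)
  have hblocks := hind.indepFun_finset₀ _ _ hdisj (by rintro (j | j | j) <;> simp [hf, hg, hh])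
  refine hblocks.comp
    (φ := fun v (j : s) => (v ⟨.inl j, by simp⟩, v ⟨.inr (.inl j), by simp⟩,
      v ⟨.inr (.inr j), by simp⟩))
    (ψ := fun v => (v ⟨.inl k, by simp⟩, v ⟨.inr (.inl k), by simp⟩,
      v ⟨.inr (.inr k), by simp⟩)) ?_ ?_ <;> fun_prop

end Independence

section QuantizedMoments

open scoped Matrix.Norms.L2Operator MatrixOrder

variable {ι Ω : Type*} [Fintype ι] [MeasurableSpace Ω] {P : Measure Ω} [IsProbabilityMeasure P]
  {r : ℝ} {X τ τ' : Ω → ι → ℝ}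

theorem integral_quantizeVec_dotProduct_sq_le (hr : 0 < r) (hX : AEMeasurable X P)
    (hτ : HasLaw τ (uniformCube ι r) P) (hXτ : IndepFun X τ P) (w : ι → ℝ) :
    ∫ ω, (quantizeVec r (X ω + τ ω) ⬝ᵥ w) ^ 2 ∂P ≤
      ∫ ω, (clipVec r (X ω) ⬝ᵥ w) ^ 2 ∂P + r ^ 2 * (w ⬝ᵥ w) := by
  have hcont : Continuous fun y : ι → ℝ => (y ⬝ᵥ w) ^ 2 := by fun_prop
  have hmeas : Measurable (Function.uncurry fun x s => (quantizeVec r (x + s) ⬝ᵥ w) ^ 2) :=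
    hcont.measurable.comp ((measurable_quantizeVec r).comp (measurable_fst.add measurable_snd))
  have hbound (x s : ι → ℝ) : |(quantizeVec r (x + s) ⬝ᵥ w) ^ 2| ≤ (r * ∑ i, |w i|) ^ 2 := by
    rw [abs_pow]
    exact pow_le_pow_left₀ (abs_nonneg _)
      (abs_dotProduct_le _ w fun i => abs_quantize_le hr.le _) 2
  have hclip : Integrable (fun ω => (clipVec r (X ω) ⬝ᵥ w) ^ 2) P :=
    integrable_dotProduct_sq ((measurable_clipVec r).comp_aemeasurable hX)
      (fun ω => norm_clipVec_le hr.le (X ω)) w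
  rw [integral_comp_of_indepFun hX hτ hXτ hmeas hbound]
  calc ∫ ω, ∫ s, (quantizeVec r (X ω + s) ⬝ᵥ w) ^ 2 ∂(uniformCube ι r) ∂P
      ≤ ∫ ω, ((clipVec r (X ω) ⬝ᵥ w) ^ 2 + r ^ 2 * (w ⬝ᵥ w)) ∂P :=
        integral_mono_of_nonneg (.of_forall fun ω => integral_nonneg fun s => sq_nonneg _)
          (hclip.add (integrable_const _))
          (.of_forall fun ω => integral_quantizeVec_add_dotProduct_sq_le hr (X ω) w)
    _ = ∫ ω, (clipVec r (X ω) ⬝ᵥ w) ^ 2 ∂P + r ^ 2 * (w ⬝ᵥ w) := by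
        rw [integral_add hclip (integrable_const _), integral_const, probReal_univ, one_smul]

theorem integral_quantizeVec_apply_mul (hr : 0 < r) (hX : AEMeasurable X P)
    (hT : HasLaw (fun ω => (τ ω, τ' ω)) ((uniformCube ι r).prod (uniformCube ι r)) P)
    (hXT : IndepFun X (fun ω => (τ ω, τ' ω)) P) (i j : ι) :
    ∫ ω, quantizeVec r (X ω + τ ω) i * quantizeVec r (X ω + τ' ω) j ∂P =
      ∫ ω, clipVec r (X ω) i * clipVec r (X ω) j ∂P := by
  have := isProbabilityMeasure_uniformCube (ι := ι) hr
  have hmeas : Measurable (Function.uncurry fun (x : ι → ℝ) (t : (ι → ℝ) × (ι → ℝ)) =>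
      quantizeVec r (x + t.1) i * quantizeVec r (x + t.2) j) := by
    unfold Function.uncurry
    fun_prop
  have hbound (x : ι → ℝ) (t : (ι → ℝ) × (ι → ℝ)) :
      |quantizeVec r (x + t.1) i * quantizeVec r (x + t.2) j| ≤ r * r := by
    rw [abs_mul]
    exact mul_le_mul (abs_quantize_le hr.le _) (abs_quantize_le hr.le _) (abs_nonneg _) hr.le
  rw [integral_comp_of_indepFun hX hT hXT hmeas hbound]
  refine integral_congr_ae (.of_forall fun ω => ?_)
  refine (integral_prod_mul (fun s => quantizeVec r (X ω + s) i)
    fun s => quantizeVec r (X ω + s) j).trans ?_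
  rw [integral_quantizeVec_add_apply hr, integral_quantizeVec_add_apply hr]

end QuantizedMoments

section QuantizedCovariance

open scoped Matrix.Norms.L2Operator MatrixOrder

variable {Ω : Type*} [MeasurableSpace Ω] {P : Measure Ω} {p : ℕ}

theorem integral_dotProduct_sq_eq {Y : Ω → Fin p → ℝ} (hY : ∀ i, MemLp (fun ω => Y ω i) 2 P)
    (w : Fin p → ℝ) : ∫ ω, (Y ω ⬝ᵥ w) ^ 2 ∂P = w ⬝ᵥ covMatrix Y P *ᵥ w := by
  have hint (i j : Fin p) : Integrable (fun ω => w i * (Y ω i * Y ω j * w j)) P :=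
    (((hY i).integrable_mul (hY j)).mul_const _).const_mul _
  calc ∫ ω, (Y ω ⬝ᵥ w) ^ 2 ∂P
      = ∫ ω, ∑ i, ∑ j, w i * (Y ω i * Y ω j * w j) ∂P := by
        simp only [dotProduct, sq, Finset.sum_mul_sum]
        congr! 4
        ring
    _ = ∑ i, ∑ j, w i * (covMatrix Y P i j * w j) := by
        rw [integral_finsetSum _ fun i _ => integrable_finsetSum _ fun j _ => hint i j]
        refine Finset.sum_congr rfl fun i _ => ?_
        rw [integral_finsetSum _ fun j _ => hint i j]
        refine Finset.sum_congr rfl fun j _ => ?_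
        rw [integral_const_mul, integral_mul_const, covMatrix, Matrix.of_apply]
    _ = w ⬝ᵥ covMatrix Y P *ᵥ w := by
        simp only [dotProduct, Matrix.mulVec, Finset.mul_sum]

theorem covMatrix_clipVec_congr {Ω₀ : Type*} [MeasurableSpace Ω₀] {P₀ : Measure Ω₀}
    {X₀ : Ω₀ → Fin p → ℝ} {X : Ω → Fin p → ℝ} (h : IdentDistrib X X₀ P P₀) (r : ℝ) :
    covMatrix (fun ω => clipVec r (X ω)) P = covMatrix (fun ω => clipVec r (X₀ ω)) P₀ := by
  ext i j
  have hm (i : Fin p) : Measurable fun x : Fin p → ℝ => clipVec r x i :=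
    (measurable_pi_apply i).comp (measurable_clipVec r)
  exact (h.comp ((hm i).mul (hm j))).integral_eq

variable {r : ℝ} {X τ τ' : Ω → Fin p → ℝ} {M S : Matrix (Fin p) (Fin p) ℝ} {β : ℝ}
  [IsProbabilityMeasure P]

theorem integral_quantizeVec_dotProduct_sq_le_norm (hr : 0 < r) (hX : AEMeasurable X P)
    (hτ : HasLaw τ (uniformCube (Fin p) r) P) (hXτ : IndepFun X τ P)
    (hβ : ∀ i j, |covMatrix (fun ω => clipVec r (X ω)) P i j - S i j| ≤ β) (w : Fin p → ℝ) :
    ∫ ω, (quantizeVec r (X ω + τ ω) ⬝ᵥ w) ^ 2 ∂P ≤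
      (‖S‖ + r ^ 2) * (w ⬝ᵥ w) + β * (∑ i, |w i|) ^ 2 := by
  have hLp (i : Fin p) : MemLp (fun ω => clipVec r (X ω) i) 2 P :=
    .of_bound ((measurable_clip r).comp_aemeasurable (hX.eval i)).aestronglyMeasurable r
      (.of_forall fun ω => abs_clip_le hr.le _)
  calc ∫ ω, (quantizeVec r (X ω + τ ω) ⬝ᵥ w) ^ 2 ∂P
      ≤ w ⬝ᵥ covMatrix (fun ω => clipVec r (X ω)) P *ᵥ w + r ^ 2 * (w ⬝ᵥ w) :=
        (integral_quantizeVec_dotProduct_sq_le hr hX hτ hXτ w).trans_eq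
          (by rw [integral_dotProduct_sq_eq hLp])
    _ ≤ w ⬝ᵥ S *ᵥ w + β * (∑ i, |w i|) ^ 2 + r ^ 2 * (w ⬝ᵥ w) := by
        gcongr
        exact dotProduct_mulVec_le_of_abs_sub_le hβ w
    _ ≤ (‖S‖ + r ^ 2) * (w ⬝ᵥ w) + β * (∑ i, |w i|) ^ 2 := by
        linarith [dotProduct_mulVec_le S w]

variable (hr : 0 < r) (hX : AEMeasurable X P)
  (hT : HasLaw (fun ω => (τ ω, τ' ω)) ((uniformCube (Fin p) r).prod (uniformCube (Fin p) r)) P)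
  (hXT : IndepFun X (fun ω => (τ ω, τ' ω)) P)
include hr hX hT hXT

theorem integral_maskedProduct_quantizeVec (hM0 : ∀ i j, 0 ≤ M i j) :
    ∫ ω, maskedProduct M (quantizeVec r (X ω + τ ω)) (quantizeVec r (X ω + τ' ω)) ∂P =
      M ⊙ covMatrix (fun ω => clipVec r (X ω)) P := by
  have hq : AEMeasurable (fun ω => quantizeVec r (X ω + τ ω)) P :=
    aemeasurable_quantizeVec_add hX hT.aemeasurable.fst
  have hq' : AEMeasurable (fun ω => quantizeVec r (X ω + τ' ω)) P :=
    aemeasurable_quantizeVec_add hX hT.aemeasurable.snd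
  have hprod : Integrable
      (fun ω => maskedProduct M (quantizeVec r (X ω + τ ω)) (quantizeVec r (X ω + τ' ω))) P :=
    integrable_comp_maskedProduct continuous_id hM0 hq hq'
      (fun ω => norm_quantizeVec_le hr.le _) (fun ω => norm_quantizeVec_le hr.le _)
  have hint (i j : Fin p) : Integrable
      (fun ω => quantizeVec r (X ω + τ ω) i * quantizeVec r (X ω + τ' ω) j) P :=
    MemLp.integrable_mul (p := 2) (q := 2)
      (.of_bound (hq.eval i).aestronglyMeasurable r (.of_forall fun ω => abs_quantize_le hr.le _))
      (.of_bound (hq'.eval j).aestronglyMeasurable r (.of_forall fun ω => abs_quantize_le hr.le _))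
  have hmean (i j : Fin p) :
      ∫ ω, quantizeVec r (X ω + τ ω) i * quantizeVec r (X ω + τ' ω) j ∂P =
        covMatrix (fun ω => clipVec r (X ω)) P i j :=
    integral_quantizeVec_apply_mul hr hX hT hXT i j
  have hsymm (i j : Fin p) : covMatrix (fun ω => clipVec r (X ω)) P j i =
      covMatrix (fun ω => clipVec r (X ω)) P i j := by
    simp only [covMatrix, Matrix.of_apply, mul_comm]
  ext i j
  refine (integral_apply hprod i j).symm.trans ?_
  simp only [maskedProduct_apply, mul_comm (quantizeVec r (X _ + τ' _) i)]
  rw [integral_const_mul, integral_div, integral_add (hint i j) (hint j i), hmean, hmean, hsymm i j,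
    add_self_div_two, Matrix.hadamard_apply]

theorem integral_maskedProduct_quantizeVec_sq_le (hM : M.IsSymm) (hM0 : ∀ i j, 0 ≤ M i j)
    (hβ0 : 0 ≤ β) (hβ : ∀ i j, |covMatrix (fun ω => clipVec r (X ω)) P i j - S i j| ≤ β) :
    ∫ ω, maskedProduct M (quantizeVec r (X ω + τ ω)) (quantizeVec r (X ω + τ' ω)) ^ 2 ∂P ≤
      (r ^ 2 * ((‖S‖ + r ^ 2) * maxColNorm M ^ 2 + β * ‖M‖ ^ 2)) • 1 := by
  have := isProbabilityMeasure_uniformCube (ι := Fin p) hr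
  have hτ : HasLaw τ (uniformCube (Fin p) r) P := measurePreserving_fst.hasLaw.comp hT
  have hτ' : HasLaw τ' (uniformCube (Fin p) r) P := measurePreserving_snd.hasLaw.comp hT
  exact integral_maskedProduct_sq_le hM hM0
    (aemeasurable_quantizeVec_add hX hτ.aemeasurable)
    (aemeasurable_quantizeVec_add hX hτ'.aemeasurable)
    (fun ω => norm_quantizeVec_le hr.le _) (fun ω => norm_quantizeVec_le hr.le _)
    (by positivity) hβ0
    (integral_quantizeVec_dotProduct_sq_le_norm hr hX hτ
      (hXT.comp measurable_id measurable_fst) hβ)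
    (integral_quantizeVec_dotProduct_sq_le_norm hr hX hτ'
      (hXT.comp measurable_id measurable_snd) hβ)
    (sum_sq_le_maxColNorm_sq M)

end QuantizedCovariance

section Concentration

open scoped Matrix.Norms.L2Operator MatrixOrder

variable {n p : ℕ} {r : ℝ} {M : Matrix (Fin p) (Fin p) ℝ}

theorem hadamard_dithEstimator_eq (x s t : Fin n → Fin p → ℝ) :
    M ⊙ dithEstimator r x s t = (n : ℝ)⁻¹ •
      ∑ k, maskedProduct M (quantizeVec r (x k + s k)) (quantizeVec r (x k + t k)) := by
  ext i j
  simp only [dithEstimator, asymEstimator, ← smul_signVec, Matrix.hadamard_apply, Matrix.add_apply,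
    Matrix.smul_apply, Matrix.transpose_apply, Matrix.sum_apply, Matrix.vecMulVec_apply,
    maskedProduct_apply, Pi.smul_apply, smul_eq_mul, Finset.mul_sum, ← Finset.sum_add_distrib]
  exact Finset.sum_congr rfl fun k _ => by ring

theorem measurable_maskedProduct_quantizeVec_add [MeasurableSpace (Matrix (Fin p) (Fin p) ℝ)]
    [BorelSpace (Matrix (Fin p) (Fin p) ℝ)] (r : ℝ) (M : Matrix (Fin p) (Fin p) ℝ) :
    Measurable fun z : (Fin p → ℝ) × (Fin p → ℝ) × (Fin p → ℝ) =>
      maskedProduct M (quantizeVec r (z.1 + z.2.1)) (quantizeVec r (z.1 + z.2.2)) := by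
  have hq : Measurable (quantizeVec r : (Fin p → ℝ) → Fin p → ℝ) := measurable_quantizeVec r
  have h : Measurable fun z : (Fin p → ℝ) × (Fin p → ℝ) × (Fin p → ℝ) =>
      (quantizeVec r (z.1 + z.2.1), quantizeVec r (z.1 + z.2.2)) :=
    (hq.comp (measurable_fst.add (measurable_fst.comp measurable_snd))).prodMk
      (hq.comp (measurable_fst.add (measurable_snd.comp measurable_snd)))
  have hM : Measurable (Function.uncurry (maskedProduct M)) :=
    (continuous_uncurry_maskedProduct M).measurable
  simpa only [Function.comp_def, Function.uncurry] using hM.comp h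

theorem maskedError_zero_left {Ω : Type*} {Xs τ τ' : Fin n → Ω → Fin p → ℝ}
    (S : Matrix (Fin p) (Fin p) ℝ) (ω : Ω) : maskedError 0 S r Xs τ τ' ω = 0 := by
  rw [maskedError, Matrix.zero_hadamard, Matrix.zero_hadamard, sub_self, opNorm, map_zero,
    norm_zero]

theorem maskedError_le {Ω : Type*} {Xs τ τ' : Fin n → Ω → Fin p → ℝ} (hn : n ≠ 0)
    (hM0 : ∀ i j, 0 ≤ M i j) {C S : Matrix (Fin p) (Fin p) ℝ} {β : ℝ} (hβ0 : 0 ≤ β)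
    (hβ : ∀ i j, |C i j - S i j| ≤ β) (ω : Ω) :
    maskedError M S r Xs τ τ' ω ≤ (n : ℝ)⁻¹ *
      ‖∑ k, (maskedProduct M (quantizeVec r (Xs k ω + τ k ω)) (quantizeVec r (Xs k ω + τ' k ω)) -
        M ⊙ C)‖ + β * ‖M‖ := by
  have hsplit : M ⊙ dithEstimator r (fun k => Xs k ω) (fun k => τ k ω) (fun k => τ' k ω) - M ⊙ S =
      (n : ℝ)⁻¹ • ∑ k, (maskedProduct M (quantizeVec r (Xs k ω + τ k ω))
        (quantizeVec r (Xs k ω + τ' k ω)) - M ⊙ C) + M ⊙ (C - S) := by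
    have hn' : (n : ℝ) ≠ 0 := Nat.cast_ne_zero.2 hn
    have hsub : M ⊙ (C - S) = M ⊙ C - M ⊙ S := Matrix.ext fun i j => mul_sub _ _ _
    rw [hadamard_dithEstimator_eq, Finset.sum_sub_distrib, Finset.sum_const, Finset.card_univ,
      Fintype.card_fin, smul_sub, ← Nat.cast_smul_eq_nsmul ℝ, inv_smul_smul₀ hn', hsub]
    abel
  rw [maskedError, opNorm_eq_norm, hsplit]
  refine (norm_add_le _ _).trans (add_le_add (le_of_eq ?_) (norm_hadamard_le hM0 hβ0 hβ))
  rw [norm_smul, norm_inv, RCLike.norm_natCast]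

variable {Ω₀ Ω : Type*} [MeasurableSpace Ω₀] [MeasurableSpace Ω] {P₀ : Measure Ω₀}
  {P : Measure Ω} {X : Ω₀ → Fin p → ℝ} {Xs τ τ' : Fin n → Ω → Fin p → ℝ}

namespace IsDitheredSample

theorem aemeasurable (hr : 0 < r) (hs : IsDitheredSample X P₀ r Xs τ τ' P)
    (k : Fin n ⊕ (Fin n ⊕ Fin n)) : AEMeasurable (Sum.elim Xs (Sum.elim τ τ') k) P := by
  rcases k with k | k | k
  exacts [(hs.identDistrib k).aemeasurable_fst, (hasLaw_uniformCube hr (hs.uniform k)).aemeasurable,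
    (hasLaw_uniformCube hr (hs.uniform' k)).aemeasurable]

theorem indepFun_dithers (hr : 0 < r) (hs : IsDitheredSample X P₀ r Xs τ τ' P) (k : Fin n) :
    IndepFun (Xs k) (fun ω => (τ k ω, τ' k ω)) P :=
  (hs.indep.indepFun_prodMk₀ (hs.aemeasurable hr) (.inr (.inl k)) (.inr (.inr k)) (.inl k)
    (by simp) (by simp)).symm

variable [IsProbabilityMeasure P]

theorem hasLaw_dithers (hr : 0 < r) (hs : IsDitheredSample X P₀ r Xs τ τ' P) (k : Fin n) :
    HasLaw (fun ω => (τ k ω, τ' k ω))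
      ((uniformCube (Fin p) r).prod (uniformCube (Fin p) r)) P := by
  have := isProbabilityMeasure_uniformCube (ι := Fin p) hr
  exact (indepFun_iff_hasLaw_prodMk_prod (hasLaw_uniformCube hr (hs.uniform k))
    (hasLaw_uniformCube hr (hs.uniform' k))).1
    (hs.indep.indepFun (i := .inr (.inl k)) (j := .inr (.inr k)) (by simp))

theorem iIndepFun_prodMk (hr : 0 < r) (hs : IsDitheredSample X P₀ r Xs τ τ' P) :
    iIndepFun (fun k ω => (Xs k ω, τ k ω, τ' k ω)) P :=
  iIndepFun_prodMk_of_sumElim hs.indep (fun k => hs.aemeasurable hr (.inl k))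
    (fun k => hs.aemeasurable hr (.inr (.inl k))) (fun k => hs.aemeasurable hr (.inr (.inr k)))

theorem integral_maskedProduct_quantizeVec (hs : IsDitheredSample X P₀ r Xs τ τ' P) (hr : 0 < r)
    (hM0 : ∀ i j, 0 ≤ M i j) (k : Fin n) :
    ∫ ω, maskedProduct M (quantizeVec r (Xs k ω + τ k ω)) (quantizeVec r (Xs k ω + τ' k ω)) ∂P =
      M ⊙ covMatrix (fun ω => clipVec r (X ω)) P₀ := by
  rw [_root_.DitheredCov.integral_maskedProduct_quantizeVec hr (hs.identDistrib k).aemeasurable_fst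
    (hs.hasLaw_dithers hr k) (hs.indepFun_dithers hr k) hM0,
    covMatrix_clipVec_congr (hs.identDistrib k)]

theorem measureReal_lt_norm_sum_sub_le [NeZero p] (hs : IsDitheredSample X P₀ r Xs τ τ' P)
    (hr : 0 < r) (hM : M.IsSymm) (hM0 : ∀ i j, 0 ≤ M i j) (hMne : M ≠ 0)
    {S : Matrix (Fin p) (Fin p) ℝ} {β : ℝ} (hβ0 : 0 ≤ β)
    (hβ : ∀ i j, |covMatrix (fun ω => clipVec r (X ω)) P₀ i j - S i j| ≤ β) {u : ℝ} (hu : 0 ≤ u) :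
    P.real {ω | 2 * √(n * (r ^ 2 * ((‖S‖ + r ^ 2) * maxColNorm M ^ 2 + β * ‖M‖ ^ 2)) * u) +
        4 * (r ^ 2 * ‖M‖) * u <
      ‖∑ k, (maskedProduct M (quantizeVec r (Xs k ω + τ k ω)) (quantizeVec r (Xs k ω + τ' k ω)) -
        M ⊙ covMatrix (fun ω => clipVec r (X ω)) P₀)‖} ≤ 2 * p * Real.exp (-u) := by
  let : MeasurableSpace (Matrix (Fin p) (Fin p) ℝ) := borel _
  have : BorelSpace (Matrix (Fin p) (Fin p) ℝ) := ⟨rfl⟩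
  let B (k : Fin n) (ω : Ω) : Matrix (Fin p) (Fin p) ℝ :=
    maskedProduct M (quantizeVec r (Xs k ω + τ k ω)) (quantizeVec r (Xs k ω + τ' k ω))
  have hXm (k : Fin n) := (hs.identDistrib k).aemeasurable_fst
  have hZm (k : Fin n) : AEMeasurable (fun ω => (Xs k ω, τ k ω, τ' k ω)) P :=
    (hXm k).prodMk (hs.hasLaw_dithers hr k).aemeasurable
  have hg := measurable_maskedProduct_quantizeVec_add r M
  have hindep : iIndepFun B P := by
    simpa only [Function.comp_def] using (hs.iIndepFun_prodMk hr).comp _ fun _ => hg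
  have hBm (k : Fin n) : AEMeasurable (B k) P := by
    simpa only [Function.comp_def] using hg.comp_aemeasurable (hZm k)
  have hherm (k : Fin n) : ∀ᵐ ω ∂P, (B k ω).IsHermitian :=
    .of_forall fun ω => isHermitian_maskedProduct hM
  have hnorm (k : Fin n) : ∀ᵐ ω ∂P, ‖B k ω‖ ≤ r ^ 2 * ‖M‖ := .of_forall fun ω =>
    norm_maskedProduct_le hM0 (norm_quantizeVec_le hr.le _) (norm_quantizeVec_le hr.le _)
  have hR0 : 0 < r ^ 2 * ‖M‖ := mul_pos (pow_pos hr 2) (norm_pos_iff.2 hMne)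
  have hvar (k : Fin n) : ∫ ω, B k ω ^ 2 ∂P ≤
      (r ^ 2 * ((‖S‖ + r ^ 2) * maxColNorm M ^ 2 + β * ‖M‖ ^ 2)) • 1 :=
    integral_maskedProduct_quantizeVec_sq_le hr (hXm k) (hs.hasLaw_dithers hr k)
      (hs.indepFun_dithers hr k) hM hM0 hβ0 (by rwa [covMatrix_clipVec_congr (hs.identDistrib k)])
  have hmean (k : Fin n) := hs.integral_maskedProduct_quantizeVec hr hM0 k
  have hbern := measureReal_lt_norm_sum_sub_integral_le hindep hBm hherm hR0 hnorm hvar hu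
  simpa only [B, hmean, Finset.sum_const, Finset.card_univ, Fintype.card_fin, nsmul_eq_mul]
    using hbern

theorem measureReal_lt_maskedError_le [NeZero p] (hs : IsDitheredSample X P₀ r Xs τ τ' P)
    (hr : 0 < r) (hn : n ≠ 0) (hM : M.IsSymm) (hM0 : ∀ i j, 0 ≤ M i j) (hMne : M ≠ 0)
    {S : Matrix (Fin p) (Fin p) ℝ} {β : ℝ} (hβ0 : 0 ≤ β)
    (hβ : ∀ i j, |covMatrix (fun ω => clipVec r (X ω)) P₀ i j - S i j| ≤ β) {u : ℝ} (hu : 0 ≤ u) :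
    P.real {ω | (n : ℝ)⁻¹ * (2 * √(n * (r ^ 2 * ((‖S‖ + r ^ 2) * maxColNorm M ^ 2 +
        β * ‖M‖ ^ 2)) * u) + 4 * (r ^ 2 * ‖M‖) * u) + β * ‖M‖ <
      maskedError M S r Xs τ τ' ω} ≤ 2 * p * Real.exp (-u) := by
  refine (measureReal_mono fun ω hω => ?_).trans
    (hs.measureReal_lt_norm_sum_sub_le hr hM hM0 hMne hβ0 hβ hu)
  have hlt := lt_of_lt_of_le hω (maskedError_le hn hM0 hβ0 hβ ω)
  exact lt_of_mul_lt_mul_left (lt_of_add_lt_add_right hlt) (by positivity)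

end IsDitheredSample

end Concentration

section ClippingBias

variable {Ω : Type*} [MeasurableSpace Ω] {P : Measure Ω} {n p : ℕ} {r : ℝ} {X : Ω → Fin p → ℝ}

theorem half_le_log_natCast (hn : 2 ≤ n) : 1 / 2 ≤ Real.log n := by
  have h : Real.log 2 ≤ Real.log n := Real.log_le_log two_pos (by exact_mod_cast hn)
  linarith [Real.log_two_gt_d9]

-- The level `r / √(2 log n)` turns the tail factor `exp (-(r / t) ^ 2)` into `n⁻²`.
theorem abs_covMatrix_clipVec_sub_le [IsFiniteMeasure P] (hn : 2 ≤ n) (hr : 0 < r)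
    (hX : AEMeasurable X P)
    (hψ : ∀ i, psi2Norm P (fun ω => X ω i) < ENNReal.ofReal (r / √(2 * Real.log n)))
    (i j : Fin p) :
    |covMatrix (fun ω => clipVec r (X ω)) P i j - covMatrix X P i j| ≤ 4 * r ^ 2 / n := by
  have hlog := half_le_log_natCast hn
  have hn0 : (0 : ℝ) < n := by positivity
  have hlevel : r / √(2 * Real.log n) ≤ r :=
    div_le_self hr.le (Real.one_le_sqrt.2 (by linarith))
  have hexponent : r ^ 2 / (r / √(2 * Real.log n)) ^ 2 = 2 * Real.log n := by
    rw [div_pow, Real.sq_sqrt (by linarith), div_div_cancel₀ (by positivity)]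
  calc |covMatrix (fun ω => clipVec r (X ω)) P i j - covMatrix X P i j|
      ≤ 4 * r ^ 2 * Real.exp (-(r ^ 2 / (r / √(2 * Real.log n)) ^ 2)) :=
        abs_integral_clip_mul_clip_sub_le hlevel (hX.eval i) (hX.eval j) (hψ i) (hψ j)
    _ ≤ 4 * r ^ 2 * Real.exp (-Real.log n) := by
        rw [hexponent]
        gcongr
        linarith
    _ = 4 * r ^ 2 / n := by rw [Real.exp_neg, Real.exp_log hn0, div_eq_mul_inv]

theorem IsSubgaussianVector.psi2Norm_apply_lt {K : ℝ} (hX : IsSubgaussianVector K X P)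
    (hn : 2 ≤ n) (hr : 0 < r)
    (hc : 4 * K ^ 2 * (Real.log n * maxNorm (covMatrix X P)) ≤ r ^ 2) (i : Fin p) :
    psi2Norm P (fun ω => X ω i) < ENNReal.ofReal (r / √(2 * Real.log n)) := by
  have hlog := half_le_log_natCast hn
  have hψ := hX.psi2Norm_le (Pi.single i 1)
  simp only [dotProduct_single, mul_one] at hψ
  set V := ∫ ω, X ω i ^ 2 ∂P
  have hV0 : 0 ≤ V := integral_nonneg fun ω => sq_nonneg _
  have hV : V ≤ maxNorm (covMatrix X P) :=
    calc V = covMatrix X P i i := by simp only [V, covMatrix, Matrix.of_apply, sq]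
      _ ≤ maxNorm (covMatrix X P) := (le_abs_self _).trans (abs_apply_le_maxNorm _ i i)
  refine hψ.trans_lt ((ENNReal.ofReal_lt_ofReal_iff (by positivity)).2 ?_)
  rw [lt_div_iff₀ (by positivity)]
  refine lt_of_pow_lt_pow_left₀ 2 hr.le ?_
  calc (K * √V * √(2 * Real.log n)) ^ 2
      = 2 * K ^ 2 * (Real.log n * V) := by
        rw [mul_pow, mul_pow, Real.sq_sqrt hV0, Real.sq_sqrt (by positivity)]
        ring
    _ ≤ 2 * K ^ 2 * (Real.log n * maxNorm (covMatrix X P)) := by gcongr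
    _ < r ^ 2 := by linarith [pow_pos hr 2]

end ClippingBias

section DeviationBounds

theorem sqrt_variance_mul_le {N m s R r ℓ u : ℝ} (hN : 0 < N) (hm : 0 ≤ m) (hs : 0 ≤ s)
    (hR : 0 ≤ R) (hr : 0 ≤ r) (hℓ : 1 / 2 ≤ ℓ) (hu : u ≤ 2 * ℓ) :
    √(N * (r ^ 2 * ((s + r ^ 2) * m ^ 2 + 4 * r ^ 2 / N * R ^ 2)) * u) ≤
      2 * (N * (m * (r * √s + r ^ 2) * √(ℓ / N))) + 4 * (r ^ 2 * R * ℓ) := by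
  set A := N * (m * (r * √s + r ^ 2) * √(ℓ / N)) with hA
  have hA0 : 0 ≤ A := by positivity
  have hA2 : N * (r ^ 2 * ((√s + r) ^ 2 * m ^ 2)) * ℓ = A ^ 2 := by
    rw [hA, mul_pow, mul_pow _ √(ℓ / N), Real.sq_sqrt (by positivity)]
    field_simp
  have hB0 : 0 ≤ r ^ 2 * R * ℓ := by positivity
  have hsr : s + r ^ 2 ≤ (√s + r) ^ 2 := by
    linarith [add_sq √s r, Real.sq_sqrt hs, mul_nonneg (Real.sqrt_nonneg s) hr]
  have hℓ2 : ℓ ≤ 2 * ℓ ^ 2 := by nlinarith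
  refine Real.sqrt_le_iff.2 ⟨by positivity, ?_⟩
  calc N * (r ^ 2 * ((s + r ^ 2) * m ^ 2 + 4 * r ^ 2 / N * R ^ 2)) * u
      = (N * (r ^ 2 * ((s + r ^ 2) * m ^ 2)) + 4 * (r ^ 2 * R) ^ 2) * u := by field_simp
    _ ≤ (N * (r ^ 2 * ((s + r ^ 2) * m ^ 2)) + 4 * (r ^ 2 * R) ^ 2) * (2 * ℓ) := by gcongr
    _ ≤ (N * (r ^ 2 * ((√s + r) ^ 2 * m ^ 2)) + 4 * (r ^ 2 * R) ^ 2) * (2 * ℓ) := by gcongr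
    _ = 2 * A ^ 2 + 8 * (r ^ 2 * R) ^ 2 * ℓ := by rw [← hA2]; ring
    _ ≤ 2 * A ^ 2 + 8 * (r ^ 2 * R) ^ 2 * (2 * ℓ ^ 2) := by gcongr
    _ ≤ (2 * A + 4 * (r ^ 2 * R * ℓ)) ^ 2 := by linarith [mul_nonneg hA0 hB0, sq_nonneg A]

theorem deviation_bound_le {N m s R r ℓ u : ℝ} (hN : 0 < N) (hm : 0 ≤ m) (hs : 0 ≤ s)
    (hR : 0 ≤ R) (hr : 0 ≤ r) (hℓ : 1 / 2 ≤ ℓ) (hu : u ≤ 2 * ℓ) :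
    N⁻¹ * (2 * √(N * (r ^ 2 * ((s + r ^ 2) * m ^ 2 + 4 * r ^ 2 / N * R ^ 2)) * u) +
      4 * (r ^ 2 * R) * u) + 4 * r ^ 2 / N * R ≤
    24 * (m * (r * √s + r ^ 2) * √(ℓ / N) + r ^ 2 * R * (ℓ / N)) := by
  have hbias : 4 * r ^ 2 / N * R ≤ N⁻¹ * (8 * (r ^ 2 * R) * ℓ) := by
    rw [inv_mul_eq_div, div_mul_eq_mul_div]
    gcongr ?_ / N
    nlinarith [mul_nonneg (sq_nonneg r) hR]
  calc _ ≤ N⁻¹ * (2 * (2 * (N * (m * (r * √s + r ^ 2) * √(ℓ / N))) + 4 * (r ^ 2 * R * ℓ)) +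
        4 * (r ^ 2 * R) * (2 * ℓ)) + N⁻¹ * (8 * (r ^ 2 * R) * ℓ) := by
        gcongr
        exact sqrt_variance_mul_le hN hm hs hR hr hℓ hu
    _ = 4 * (m * (r * √s + r ^ 2) * √(ℓ / N)) + 24 * (r ^ 2 * R * (ℓ / N)) := by
        field_simp
        ring
    _ ≤ 24 * (m * (r * √s + r ^ 2) * √(ℓ / N) + r ^ 2 * R * (ℓ / N)) := by
        have : 0 ≤ m * (r * √s + r ^ 2) * √(ℓ / N) := by positivity
        linarith

theorem rescaled_bound_le {L m s T R r a q : ℝ} (hL : 1 / 2 ≤ L) (hm : 0 ≤ m) (hT : 0 ≤ T)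
    (hTs : T ≤ s) (hR : 0 ≤ R) (hq : 0 ≤ q) (hra : r ^ 2 ≤ a * (L * T)) :
    24 * (m * (r * √s + r ^ 2) * √q + r ^ 2 * R * q) ≤
      96 * (1 + |a|) * (L * m * √(s * T * q) + L * R * T * q) := by
  set b := 1 + |a|
  have hb1 : 1 ≤ b := le_add_of_nonneg_right (abs_nonneg a)
  have hL0 : 0 < L := one_half_pos.trans_le hL
  have hs : 0 ≤ s := hT.trans hTs
  have hrT : r ^ 2 ≤ b * (L * T) := hra.trans (by gcongr; linarith [le_abs_self a])
  have hTle : T ≤ √(s * T) := Real.le_sqrt_of_sq_le (by rw [sq]; gcongr)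
  have hrs : r * √s ≤ 2 * b * (L * √(s * T)) := by
    refine le_of_sq_le_sq ?_ (by positivity)
    calc (r * √s) ^ 2 = r ^ 2 * s := by rw [mul_pow, Real.sq_sqrt hs]
      _ ≤ b * (L * T) * s := by gcongr
      _ = b * L * (s * T) := by ring
      _ ≤ b ^ 2 * (4 * L ^ 2) * (s * T) := by
          gcongr
          · exact le_self_pow₀ hb1 two_ne_zero
          · nlinarith
      _ = (2 * b * (L * √(s * T))) ^ 2 := by
          rw [mul_pow, mul_pow, mul_pow, Real.sq_sqrt (by positivity)]
          ring
  have hfirst : m * (r * √s + r ^ 2) * √q ≤ 4 * b * (L * m * (√(s * T) * √q)) :=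
    calc m * (r * √s + r ^ 2) * √q
        ≤ m * (2 * b * (L * √(s * T)) + b * (L * √(s * T))) * √q := by
          gcongr
          exact hrT.trans (by gcongr)
      _ ≤ 4 * b * (L * m * (√(s * T) * √q)) := by
          have : 0 ≤ b * (L * m * (√(s * T) * √q)) := by positivity
          linarith
  have hsecond : r ^ 2 * R * q ≤ 4 * b * (L * R * T * q) :=
    calc r ^ 2 * R * q ≤ b * (L * T) * R * q := by gcongr
      _ ≤ 4 * b * (L * R * T * q) := by
          have : 0 ≤ b * (L * R * T * q) := by positivity
          linarith
  rw [Real.sqrt_mul (by positivity)]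
  linarith

end DeviationBounds

section MaskedError

variable {Ω₀ Ω : Type*} [MeasurableSpace Ω₀] [MeasurableSpace Ω] {P₀ : Measure Ω₀}
  {P : Measure Ω} [IsProbabilityMeasure P] {n p : ℕ} {r t : ℝ} {X : Ω₀ → Fin p → ℝ}
  {Xs τ τ' : Fin n → Ω → Fin p → ℝ} {M : Matrix (Fin p) (Fin p) ℝ}

theorem ofReal_one_sub_exp_le_measure_of_measureReal_lt_le {f : Ω → ℝ} {b : ℝ}
    (h : P.real {ω | b < f ω} ≤ Real.exp (-t)) :
    ENNReal.ofReal (1 - Real.exp (-t)) ≤ P {ω | f ω ≤ b} := by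
  have hcover : 1 ≤ P.real {ω | f ω ≤ b} + P.real {ω | b < f ω} := by
    rw [← probReal_univ (μ := P)]
    exact (measureReal_mono fun ω _ => le_or_gt (f ω) b).trans (measureReal_union_le _ _)
  rw [ENNReal.ofReal_le_iff_le_toReal (measure_ne_top _ _)]
  change _ ≤ P.real _
  linarith

theorem log_two_le_log_add (ht : 0 ≤ t) (hpt : 2 ≤ p ∨ 1 ≤ t) :
    Real.log 2 ≤ Real.log p + t := by
  rcases hpt with hp | ht1
  · exact le_add_of_le_of_nonneg (Real.log_le_log two_pos (by exact_mod_cast hp)) ht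
  · linarith [Real.log_two_lt_d9, Real.log_natCast_nonneg p]

theorem IsDitheredSample.ofReal_le_measure_maskedError_le [IsFiniteMeasure P₀]
    (hs : IsDitheredSample X P₀ r Xs τ τ' P) (hn : 2 ≤ n) (hr : 0 < r) (hX : AEMeasurable X P₀)
    (hψ : ∀ i, psi2Norm P₀ (fun ω => X ω i) < ENNReal.ofReal (r / √(2 * Real.log n)))
    (hM : M.IsSymm) (hM0 : ∀ i j, 0 ≤ M i j) (ht : 0 ≤ t) (hpt : 2 ≤ p ∨ 1 ≤ t) :
    ENNReal.ofReal (1 - Real.exp (-t)) ≤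
      P {ω | maskedError M (covMatrix X P₀) r Xs τ τ' ω ≤
        24 * (maxColNorm M * (r * √(opNorm (covMatrix X P₀)) + r ^ 2) *
          √((Real.log p + t) / n) + r ^ 2 * opNorm M * ((Real.log p + t) / n))} := by
  have hℓ := log_two_le_log_add ht hpt
  have hlog2 := Real.log_two_gt_d9
  have hn0 : (0 : ℝ) < n := by positivity
  have hm := maxColNorm_nonneg M
  have hR := opNorm_nonneg M
  rcases eq_or_ne M 0 with rfl | hMne
  · refine (ENNReal.ofReal_le_one.2 (by linarith [Real.exp_pos (-t)])).trans_eq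
      (measure_univ.symm.trans (congrArg P (Set.eq_univ_of_forall fun ω => ?_).symm))
    rw [Set.mem_ofPred_eq, maskedError_zero_left]
    have : 0 ≤ Real.log p + t := by linarith
    positivity
  refine ofReal_one_sub_exp_le_measure_of_measureReal_lt_le ?_
  have : NeZero p := ⟨fun h => hMne (by subst h; exact Subsingleton.elim _ _)⟩
  have htail := hs.measureReal_lt_maskedError_le hr (by positivity) hM hM0 hMne
    (β := 4 * r ^ 2 / n) (by positivity) (abs_covMatrix_clipVec_sub_le hn hr hX hψ)
    (u := Real.log p + t + Real.log 2) (by linarith)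
  refine (measureReal_mono (Set.ofPred_subset_ofPred.2 fun ω hω => ?_)).trans
    (htail.trans_eq ?_)
  · exact (deviation_bound_le hn0 hm (opNorm_nonneg _) hR hr.le (by linarith)
      (by linarith)).trans_lt hω
  · rw [show -(Real.log p + t + Real.log 2) = -t - Real.log p - Real.log 2 by ring, Real.exp_sub,
      Real.exp_sub, Real.exp_log (Nat.cast_pos.2 (NeZero.pos p)), Real.exp_log two_pos]
    have hp : (p : ℝ) ≠ 0 := NeZero.ne _
    field_simp

end MaskedError

end DitheredCov

open DitheredCov in
theorem theorem2_general {Ω₀ Ω : Type*} [MeasurableSpace Ω₀] [MeasurableSpace Ω]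
    {P₀ : Measure Ω₀} {P : Measure Ω} [IsProbabilityMeasure P₀] [IsProbabilityMeasure P]
    {n p : ℕ} (hn : 2 ≤ n) {X : Ω₀ → Fin p → ℝ} (hX : AEMeasurable X P₀)
    {M : Matrix (Fin p) (Fin p) ℝ} (hM : M.IsSymm) (hM0 : ∀ i j, 0 ≤ M i j)
    {lam : ℝ} (hlam : 0 < lam)
    (hψ : ∀ i, psi2Norm P₀ (fun ω => X ω i) < ENNReal.ofReal (lam / √(2 * Real.log n)))
    {Xs τ τ' : Fin n → Ω → Fin p → ℝ} (hs : IsDitheredSample X P₀ lam Xs τ τ' P)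
    {t : ℝ} (ht : 0 ≤ t) (hpt : 2 ≤ p ∨ 1 ≤ t) :
    ENNReal.ofReal (1 - Real.exp (-t)) ≤
      P {ω | maskedError M (covMatrix X P₀) lam Xs τ τ' ω ≤
        24 * (maxColNorm M * (lam * √(opNorm (covMatrix X P₀)) + lam ^ 2) *
          √((Real.log p + t) / n) + lam ^ 2 * opNorm M * ((Real.log p + t) / n))} ∧
    ∀ a : ℝ, lam ^ 2 ≤ a * (Real.log n * maxNorm (covMatrix X P₀)) →
      ENNReal.ofReal (1 - Real.exp (-t)) ≤
        P {ω | maskedError M (covMatrix X P₀) lam Xs τ τ' ω ≤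
          96 * (1 + |a|) * (Real.log n * maxColNorm M *
              √(opNorm (covMatrix X P₀) * maxNorm (covMatrix X P₀) * (Real.log p + t) / n) +
            Real.log n * opNorm M * maxNorm (covMatrix X P₀) * ((Real.log p + t) / n))} := by
  have hmain := hs.ofReal_le_measure_maskedError_le hn hlam hX hψ hM hM0 ht hpt
  refine ⟨hmain, fun a ha => hmain.trans (measure_mono (Set.ofPred_subset_ofPred.2 fun ω hω =>
    hω.trans ?_))⟩
  have hq : 0 ≤ (Real.log p + t) / n :=
    div_nonneg (add_nonneg (Real.log_natCast_nonneg p) ht) n.cast_nonneg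
  rw [mul_div_assoc (opNorm _ * maxNorm _)]
  exact rescaled_bound_le (half_le_log_natCast hn) (maxColNorm_nonneg M) (maxNorm_nonneg _)
    (maxNorm_le_opNorm _) (opNorm_nonneg M) hq ha

theorem theorem2 (K : ℝ) (hK : 0 < K) :
    ∃ (c C : ℝ) (C' : ℝ → ℝ), 0 < c ∧ 0 < C ∧ (∀ a, 0 < C' a) ∧
      ∀ {Ω₀ : Type*} {Ω : Type*} [MeasurableSpace Ω₀] [MeasurableSpace Ω]
        (P₀ : Measure Ω₀) (P : Measure Ω) [IsProbabilityMeasure P₀] [IsProbabilityMeasure P]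
        (n p : ℕ) (_hn : 2 ≤ n) (_hp : 1 ≤ p)
        (X : Ω₀ → Fin p → ℝ) (_hX : DitheredCov.IsSubgaussianVector K X P₀)
        (S : Matrix (Fin p) (Fin p) ℝ) (_hS : S = DitheredCov.covMatrix X P₀)
        (M : Matrix (Fin p) (Fin p) ℝ) (_hM : M.IsSymm)
        (_hM01 : ∀ i j, M i j ∈ Set.Icc (0 : ℝ) 1)
        (lam : ℝ) (_hlam : 0 < lam)
        (Xs τ τ' : Fin n → Ω → Fin p → ℝ)
        (_hXs : DitheredCov.IsDitheredSample X P₀ lam Xs τ τ' P)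
        (t : ℝ) (_ht : 0 ≤ t) (_hpt : 2 ≤ p ∨ 1 ≤ t)
        (_hc : c * (Real.log n * DitheredCov.maxNorm S) ≤ lam ^ 2),
        ENNReal.ofReal (1 - Real.exp (-t)) ≤
          P {ω | DitheredCov.maskedError M S lam Xs τ τ' ω ≤
            C * (DitheredCov.maxColNorm M *
                (lam * Real.sqrt (DitheredCov.opNorm S) + lam ^ 2) *
                Real.sqrt ((Real.log p + t) / n) +
              lam ^ 2 * DitheredCov.opNorm M * ((Real.log p + t) / n))} ∧
        ∀ a : ℝ, lam ^ 2 ≤ a * (Real.log n * DitheredCov.maxNorm S) →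
          ENNReal.ofReal (1 - Real.exp (-t)) ≤
            P {ω | DitheredCov.maskedError M S lam Xs τ τ' ω ≤
              C' a * (Real.log n * DitheredCov.maxColNorm M *
                  Real.sqrt (DitheredCov.opNorm S * DitheredCov.maxNorm S *
                    (Real.log p + t) / n) +
                Real.log n * DitheredCov.opNorm M * DitheredCov.maxNorm S *
                  ((Real.log p + t) / n))} := by
  refine ⟨4 * K ^ 2, 24, fun a => 96 * (1 + |a|), by positivity, by norm_num,
    fun a => by positivity, ?_⟩
  rintro Ω₀ Ω _ _ P₀ P _ _ n p hn - X hX _ rfl M hM hM01 lam hlam Xs τ τ' hXs t ht hpt hc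
  exact theorem2_general hn hX.aemeasurable hM (fun i j => (hM01 i j).1) hlam
    (hX.psi2Norm_apply_lt hn hlam hc) hXs ht hpt
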